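/- **Setting.** Let $t$ be a parameter ranging over $\mathbb Z$, and let variables range over $\mathbb Z$. A *linear constraint* is $\tau = 0$, $\tau \le 0$ or $f(t) \mid \tau$, where $f\in\mathbb Z[t]$ and $\tau = f_0(t)+\sum_i f_i(t)\,v_i$ with $f_i\in\mathbb Z[t]$ is a linear term; $f(t)\mid \tau$ means $\tau=0$ when $f(t)=0$. For $f\in\mathbb Z[t]$, $f(t)>0$ abbreviates $1-f(t)\le 0$. A *positive Boolean combination* is built with $\wedge,\vee$ only. For a finite map $B$ from variables to $\mathbb Z[t]$ with keys $\vec w$, $\exists\vec w\le B:\psi$ means $\exists \vec w:\bigwedge_i (0\le w_i\le B(w_i)(t))\wedge\psi$. **Procedure BoundedQE.** The input is $\exists\vec x:\varphi(\vec x,\vec z)$ with $\varphi$ a positive Boolean combination of linear constraints and $\vec x$ a finite sequence of distinct variables. Each guess below opens one non-deterministic branch per possible choice. 1. Guess a set $Z$ of divisors $f$ of divisibility constraints of $\varphi$. For each $f\in Z$, replace every $f(t)\mid\tau$ in $\varphi$ by $\tau=0$ and add the conjunct $f(t)=0$. Guess a sign $\pm$ and let $m:=\pm\prod f$ over the set of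 divisors $f$ now occurring in $\varphi$; let $\chi:=(m(t)>0)$. Let $\ell:=1$, set the current sign to $+$, and let $B$ be the empty map. Replace each occurrence of an inequality $\tau\le0$ in $\varphi$ by $\tau+y=0$, with a fresh slack variable $y$ for each occurrence. 2. For each $x$ in $\vec x$, in order, guess one of the following. (a) Set $B(x):=m-1$ and go to the next variable. (b) Choose an equality $f(t)\,x+\tau=0$ of $\varphi$ in which $x$ occurs (that is, $f$ is not the zero polynomial) and a sign $\pm$, which becomes the current sign. Let $p:=\ell$ and then $\ell:=f$; conjoin $\pm f(t)>0$ to $\chi$; let $m:=\pm f\cdot m$. If $\tau$ contains a slack variable $y$ on which $B$ is undefined, set $B(y):=m-1$ (with the new $m$). In $\varphi$ replace each equality $h\,x+\rho=0$ by $f\rho-h\tau=0$, and each divisibility $g\mid h\,x+\rho$ by $fg\mid f\rho-h\tau$ (also when $h=0$). Divide all polynomials of all constraints of $\varphi$, including the divisors, by $p$. Conjoin $f(t)\mid\tau$ to $\varphi$. 3. Replace each equality $\eta=0$ of $\varphi$ that contains a slack variable $y$ on which $B$ is undefined by $\eta[0/y]\le0$ if the current sign is $+$, and by $\eta[0/y]\ge0$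 if it is $-$. Return $\exists\vec w\le B:\varphi\wedge\chi$, where $\vec w$ are the keys of $B$. **Lemma (correctness of BoundedQE).** For every such input $\exists\vec x:\varphi(\vec x,\vec z)$: * every branch $\beta$ returns a formula $\exists\vec w_\beta\le B_\beta:\psi_\beta(\vec w_\beta,\vec z)$, where $\psi_\beta$ is a positive Boolean combination of linear constraints, $\vec w_\beta$ consists of variables of $\vec x$ and slack variables, and every variable of $\psi_\beta$ is in $\vec w_\beta$ or is a variable of $\varphi$ not in $\vec x$; * there are finitely many branches, and $\bigvee_\beta \exists\vec w_\beta\le B_\beta:\psi_\beta$ is equivalent to $\exists\vec x:\varphi$, for every $t\in\mathbb Z$ and all integer values of the free variables; * in every branch, all divisions by $p$ in step 2(b) are divisions by a nonzero polynomial and are without remainder in $\mathbb Z[t]$. In particular, there is a non-deterministic procedure that replaces $\exists\vec x$ by bounded quantifiers in this sense. -/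

import Mathlib

open Polynomial

namespace PPA

/-! ### Syntax and semantics of formulae with linear constraints over `ℤ[t]` -/

/-- A linear term `f₀(t) + ∑ᵥ fᵥ(t) · v` with `f₀, fᵥ ∈ ℤ[t]`, stored as the pair
(constant `f₀`, finitely supported family of coefficients). Terms form a `ℤ[t]`-module. -/
abbrev LinTerm (V : Type*) := ℤ[X] × (V →₀ ℤ[X])

/-- Value of a linear term when the parameter is `t` and the variables are valued by `ν`. -/
noncomputable def LinTerm.eval {V : Type*} (t : ℤ) (ν : V → ℤ) (τ : LinTerm V) : ℤ :=
  Polynomial.eval t τ.1 + τ.2.sum fun v f => Polynomial.eval t f * ν v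

/-- The term `f(t)`, without variables. -/
noncomputable def LinTerm.const {V : Type*} (f : ℤ[X]) : LinTerm V := (f, 0)

/-- Linear constraints: `τ = 0`, `τ ≤ 0` and `f(t) ∣ τ`. -/
inductive Constraint (V : Type*) where
  | eq (τ : LinTerm V)
  | le (τ : LinTerm V)
  | dvd (f : ℤ[X]) (τ : LinTerm V)

/-- Divisibility in `ℤ` is the divisibility relation of the theory: `0 ∣ x` holds iff `x = 0`, and
for `d ≠ 0`, `d ∣ x` holds iff the remainder of `x` modulo `d` is `0`. -/
def Constraint.Holds {V : Type*} (t : ℤ) (ν : V → ℤ) : Constraint V → Prop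
  | .eq τ => τ.eval t ν = 0
  | .le τ => τ.eval t ν ≤ 0
  | .dvd f τ => Polynomial.eval t f ∣ τ.eval t ν

/-- The term of a constraint. -/
def Constraint.term {V : Type*} : Constraint V → LinTerm V
  | .eq τ => τ
  | .le τ => τ
  | .dvd _ τ => τ

/-- Positive Boolean combinations of atoms from `A`. -/
inductive PosBool (A : Type*) where
  | atom (a : A)
  | and (φ ψ : PosBool A)
  | or (φ ψ : PosBool A)

/-- Truth of a positive Boolean combination, given the truth of the atoms. -/
def PosBool.Holds {A : Type*} (p : A → Prop) : PosBool A → Prop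
  | .atom a => p a
  | .and φ ψ => φ.Holds p ∧ ψ.Holds p
  | .or φ ψ => φ.Holds p ∨ ψ.Holds p

/-- Replace every atom `a` by the atom `f a`, keeping the Boolean structure. -/
def PosBool.map {A B : Type*} (f : A → B) : PosBool A → PosBool B
  | .atom a => .atom (f a)
  | .and φ ψ => .and (φ.map f) (ψ.map f)
  | .or φ ψ => .or (φ.map f) (ψ.map f)

/-- The occurrences of atoms. -/
def PosBool.atoms {A : Type*} : PosBool A → List A
  | .atom a => [a]
  | .and φ ψ => φ.atoms ++ ψ.atoms
  | .or φ ψ => φ.atoms ++ ψ.atoms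

/-- Positive Boolean combinations of linear constraints. -/
abbrev Formula (V : Type*) := PosBool (Constraint V)

/-- Satisfaction of a quantifier-free formula. -/
def Formula.Sat {V : Type*} (t : ℤ) (ν : V → ℤ) (φ : Formula V) : Prop :=
  φ.Holds (Constraint.Holds t ν)

/-- Satisfaction of `∃ xs : φ`. -/
def Formula.ExSat {V : Type*} (xs : List V) (t : ℤ) (ν : V → ℤ) (φ : Formula V) : Prop :=
  ∃ ν' : V → ℤ, (∀ v, v ∉ xs → ν' v = ν v) ∧ φ.Sat t ν'

/-- The variables occurring in a formula. -/
def Formula.vars {V : Type*} (φ : Formula V) : Set V :=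
  {v | ∃ c ∈ φ.atoms, c.term.2 v ≠ 0}

/-- The constraint `f(t) > 0`, that is, `0 - f(t) + 1 ≤ 0`. -/
noncomputable def Formula.pos {V : Type*} (f : ℤ[X]) : Formula V :=
  .atom (.le (LinTerm.const (0 - f + 1)))

/-- The divisors `f(t)` of the divisibility constraints occurring in a formula. -/
def Formula.divisors {V : Type*} (φ : Formula V) : List ℤ[X] :=
  φ.atoms.filterMap fun
    | .dvd f _ => some f
    | _ => none

/-- The (terms `η` of the) equalities `η = 0` occurring in a formula. -/
def Formula.equalities {V : Type*} (φ : Formula V) : List (LinTerm V) :=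
  φ.atoms.filterMap fun
    | .eq η => some η
    | _ => none

/-- A map from variables to polynomials, with finite set of keys `dom`; the values of `bound`
outside of `dom` play no role. -/
structure BoundMap (V : Type*) where
  dom : Finset V
  bound : V → ℤ[X]

/-- A formula `∃ w ≤ B : ψ`, where `w` are the keys of `B`. -/
structure BoundedFormula (V : Type*) where
  B : BoundMap V
  body : Formula V

/-- Satisfaction of `∃ w ≤ B : ψ`, that is, of `∃ w : ⋀ᵢ (0 ≤ wᵢ ≤ B(wᵢ)(t)) ∧ ψ`. -/
def BoundedFormula.Sat {V : Type*} (t : ℤ) (ν : V → ℤ) (F : BoundedFormula V) : Prop :=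
  ∃ ν' : V → ℤ, (∀ v, v ∉ F.B.dom → ν' v = ν v) ∧
    (∀ w ∈ F.B.dom, 0 ≤ ν' w ∧ ν' w ≤ Polynomial.eval t (F.B.bound w)) ∧
    F.body.Sat t ν'

/-! ### The steps of the procedure -/

open Classical in
/-- The quotient `f / ℓ` in `ℤ[t]`, for `ℓ ≠ 0` dividing `f` (and `0` by convention otherwise). -/
noncomputable def exactDiv (ℓ f : ℤ[X]) : ℤ[X] :=
  if h : ℓ ≠ 0 ∧ ℓ ∣ f then Classical.choose h.2 else 0

theorem exactDiv_zero (ℓ : ℤ[X]) : exactDiv ℓ 0 = 0 := by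
  unfold exactDiv
  split_ifs with h
  · have := Classical.choose_spec h.2
    rcases mul_eq_zero.mp this.symm with h0 | h0
    · exact absurd h0 h.1
    · exact h0
  · rfl

/-- Divide all polynomials of a term by `ℓ`. -/
noncomputable def LinTerm.divBy {V : Type*} (ℓ : ℤ[X]) (τ : LinTerm V) : LinTerm V :=
  (exactDiv ℓ τ.1, τ.2.mapRange (exactDiv ℓ) (exactDiv_zero ℓ))

/-- Divide a constraint by `ℓ`; for divisibility constraints both sides are divided. (Inequalities
do not occur in the formulae to which this is applied.) -/
noncomputable def Constraint.divBy {V : Type*} (ℓ : ℤ[X]) : Constraint V → Constraint V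
  | .eq ρ => .eq (ρ.divBy ℓ)
  | .le ρ => .le ρ
  | .dvd g ρ => .dvd (exactDiv ℓ g) (ρ.divBy ℓ)

/-- All polynomials of the term are multiples of `ℓ` in `ℤ[t]`. -/
def LinTerm.DivisibleBy {V : Type*} (ℓ : ℤ[X]) (τ : LinTerm V) : Prop :=
  ℓ ∣ τ.1 ∧ ∀ v, ℓ ∣ τ.2 v

/-- All polynomials of the constraint (with the divisor, for divisibility constraints) are multiples
of `ℓ` in `ℤ[t]`, and the constraint is not an inequality: dividing it by `ℓ` leaves no
remainder. -/
def Constraint.DivisibleBy {V : Type*} (ℓ : ℤ[X]) : Constraint V → Prop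
  | .eq ρ => ρ.DivisibleBy ℓ
  | .le _ => False
  | .dvd g ρ => ℓ ∣ g ∧ ρ.DivisibleBy ℓ

/-- Remove the summand of the variable `x` from a term. -/
noncomputable def LinTerm.erase {V : Type*} (x : V) (τ : LinTerm V) : LinTerm V :=
  (τ.1, τ.2.erase x)

/-- Multiply `ρ = h · x + ρ'` by `f`, and replace `f · x` by `-τ`: the result is
`f · ρ' - h · τ`. -/
noncomputable def LinTerm.vigSub {V : Type*} (f : ℤ[X]) (τ : LinTerm V) (x : V) (ρ : LinTerm V) :
    LinTerm V :=
  f • ρ.erase x - ρ.2 x • τ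

/-- The vigorous substitution of `-τ / f` for `x` in a constraint. (Inequalities do not occur in the
formulae to which this is applied.) -/
noncomputable def Constraint.vigSub {V : Type*} (f : ℤ[X]) (τ : LinTerm V) (x : V) :
    Constraint V → Constraint V
  | .eq ρ => .eq (LinTerm.vigSub f τ x ρ)
  | .le ρ => .le ρ
  | .dvd g ρ => .dvd (f * g) (LinTerm.vigSub f τ x ρ)

open Classical in
/-- Replace each `f(t) ∣ τ` with `f ∈ Z` by `τ = 0`, and add the conjuncts `f(t) = 0`, `f ∈ Z`. -/
noncomputable def zeroDivisors {V : Type*} (Z : List ℤ[X]) (φ : Formula V) : Formula V :=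
  Z.foldl (fun ψ f => ψ.and (.atom (.eq (LinTerm.const f))))
    (φ.map fun
      | .dvd f τ => if f ∈ Z then .eq τ else .dvd f τ
      | c => c)

/-- The term `τ`, over the variables extended with the slack variables. -/
noncomputable def LinTerm.lift {V : Type*} (τ : LinTerm V) : LinTerm (V ⊕ ℕ) :=
  (τ.1, τ.2.mapDomain Sum.inl)

/-- The number of occurrences of inequalities. -/
def numLe {V : Type*} : Formula V → ℕ
  | .atom (.le _) => 1
  | .atom _ => 0
  | .and φ ψ => numLe φ + numLe ψ
  | .or φ ψ => numLe φ + numLe ψ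

/-- Replace each inequality `τ ≤ 0` by `τ + y = 0`, where `y` is a fresh slack variable. The slack
variables are `Sum.inr k`, and `k` is the first index that may be used. -/
noncomputable def addSlack {V : Type*} : Formula V → ℕ → Formula (V ⊕ ℕ)
  | .atom (.eq τ), _ => .atom (.eq τ.lift)
  | .atom (.le τ), k => .atom (.eq (τ.lift + (0, Finsupp.single (Sum.inr k) 1)))
  | .atom (.dvd f τ), _ => .atom (.dvd f τ.lift)
  | .and φ ψ, k => .and (addSlack φ k) (addSlack ψ (k + numLe φ))
  | .or φ ψ, k => .or (addSlack φ k) (addSlack ψ (k + numLe φ))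

/-- The values of the program variables. The sign is `1` or `-1`. -/
structure State (V : Type*) where
  φ : Formula (V ⊕ ℕ)
  m : ℤ[X]
  lead : ℤ[X]
  sign : ℤ
  B : BoundMap (V ⊕ ℕ)
  χ : Formula (V ⊕ ℕ)

open Classical in
/-- The state before the main loop, for the guesses `Z` (a set of divisors that are assumed to
vanish) and `s` (the sign of the product of the other divisors). -/
noncomputable def initState {V : Type*} (φ : Formula V) (Z : List ℤ[X]) (s : ℤ) : State V :=
  let φ' := zeroDivisors Z φ
  let m := C s * φ'.divisors.dedup.prod
  { φ := addSlack φ' 0, m := m, lead := 1, sign := 1, B := ⟨∅, fun _ => 0⟩, χ := Formula.pos m }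

open Classical in
/-- The states before the main loop, over all guesses. -/
noncomputable def initStates {V : Type*} (φ : Formula V) : List (State V) :=
  φ.divisors.dedup.sublists.flatMap fun Z => [1, -1].map fun s => initState φ Z s

open Classical in
/-- The iteration that does not eliminate `x`, but bounds it by `m(t) - 1`. -/
noncomputable def skip {V : Type*} (x : V) (S : State V) : State V :=
  { S with B := ⟨insert (.inl x) S.B.dom, Function.update S.B.bound (.inl x) (S.m - 1)⟩ }

/-- `v` is a slack variable to which the map `B` assigns no bound. -/
def FreeSlack {V : Type*} (B : BoundMap (V ⊕ ℕ)) (v : V ⊕ ℕ) : Prop :=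
  v.isRight ∧ v ∉ B.dom

open Classical in
/-- The iteration that eliminates `x` with the equality `η = f · x + τ = 0` and the guess `s` for
the sign of `f`. (At most one slack variable that occurs in `τ` has no bound yet.) -/
noncomputable def eliminate {V : Type*} (x : V) (η : LinTerm (V ⊕ ℕ)) (s : ℤ) (S : State V) :
    State V :=
  let f := η.2 (.inl x)
  let τ := η.erase (.inl x)
  let m := C s * f * S.m
  let new := τ.2.support.filter (FreeSlack S.B)
  { φ := .and ((S.φ.map (Constraint.vigSub f τ (.inl x))).map (Constraint.divBy S.lead))
      (.atom (.dvd f τ))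
    m := m
    lead := f
    sign := s
    B := ⟨S.B.dom ∪ new, fun v => if v ∈ new then m - 1 else S.B.bound v⟩
    χ := .and S.χ (Formula.pos (C s * f)) }

open Classical in
/-- The equalities that can be guessed to eliminate `x`: those that contain `x`. -/
noncomputable def pivots {V : Type*} (x : V) (S : State V) : List (LinTerm (V ⊕ ℕ)) :=
  S.φ.equalities.filter fun η => η.2 (.inl x) ≠ 0

/-- One iteration of the main loop, over all guesses. -/
noncomputable def iteration {V : Type*} (x : V) (S : State V) : List (State V) :=
  skip x S :: (pivots x S).flatMap fun η => [1, -1].map fun s => eliminate x η s S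

/-- The main loop, over all guesses. -/
noncomputable def loop {V : Type*} : List V → State V → List (State V)
  | [], S => [S]
  | x :: xs, S => (iteration x S).flatMap (loop xs)

open Classical in
/-- Replace each equality `η = 0` containing a slack variable `y` without bound by `η[0/y] ≤ 0` when
the sign is plus, and by `η[0/y] ≥ 0` (that is, `-η[0/y] ≤ 0`) when the sign is minus. -/
noncomputable def Constraint.dropSlack {V : Type*} (B : BoundMap (V ⊕ ℕ)) (s : ℤ) :
    Constraint (V ⊕ ℕ) → Constraint (V ⊕ ℕ)
  | .eq η =>
    if ∃ y, FreeSlack B y ∧ η.2 y ≠ 0 then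
      let η' : LinTerm (V ⊕ ℕ) := (η.1, η.2.filter fun v => ¬ FreeSlack B v)
      if s = 1 then .le η' else .le (-η')
    else .eq η
  | c => c

/-- The output of a branch that ends its main loop in the state `S`. -/
noncomputable def finish {V : Type*} (S : State V) : BoundedFormula (V ⊕ ℕ) :=
  { B := S.B, body := .and (S.φ.map (Constraint.dropSlack S.B S.sign)) S.χ }

/-- The non-deterministic procedure BoundedQE on the input `∃ xs : φ`: the list of the outputs of
all branches. -/
noncomputable def boundedQE {V : Type*} (xs : List V) (φ : Formula V) :
    List (BoundedFormula (V ⊕ ℕ)) :=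
  ((initStates φ).flatMap (loop xs)).map finish

end PPA

/-! The loop is Bareiss' fraction-free Gaussian elimination. When the variables `c j` have been
eliminated with pivots that descend from the equalities `r i = 0` of the slack form of the input,
let `p` be the determinant of the coefficients of the `c j` in the `r i`. Every current constraint
is the reduction of an initial one: its term `ρ` has become `p • ρ` minus an adjugate combination of
the `r i`, which contains no `c j`, and a divisor `g` has become `p * g`. A further pivot turns `p`
into the next determinant `f`, and the cross-multiplied rows are exactly `p` times the new
reductions (`smul_reduce_sum`), so the divisions are exact. The conjoined constraint `f ∣ τ` is the
reduction of the trivial `1 ∣ -x` (`elimTerm_neg_varTerm`). This closed form is the core of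
`Invariant`.

Soundness (`Invariant.exists_sat_of_finish`): `χ` forces `p(t) ≠ 0`, the reduced constraints `1 ∣
-x` provide integer values for the eliminated variables, and at these values each reduced term is
`p(t)` times the original one. A slack variable without bound occurs in no `r i`, so its coefficient
is `0` or `p`, and the recorded sign of `p(t)` restores the direction of its inequality.

Completeness (`Invariant.exists_iteration`): follow a solution through the loop. If a true equality
without free slack variable has a nonzero `x`-coefficient at `t`, use it as pivot. Otherwise `x` can
be shifted by multiples of `m(t)` while free slack variables compensate: `p ∣ m` makes the
compensation integral, and divisibilities persist because their divisors divide `m`. Either some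
slack variable moves, and the shift goes on until one of them is below its slope and its equality
can be the pivot, or none moves and `x` is reduced modulo `m(t)`. -/

namespace PPA

/-! ### Fraction-free elimination -/

section Bareiss

open Matrix

variable {R M ι : Type*} [CommRing R] [AddCommGroup M] [Module R M] [Fintype ι]

/-- The matrix of the coordinates `κ j` of the vectors `r i`. -/
def coordMatrix (r : ι → M) (κ : ι → M →ₗ[R] R) : Matrix ι ι R := Matrix.of fun i j => κ j (r i)

theorem coord_sum (r : ι → M) (κ : ι → M →ₗ[R] R) (d : ι → R) (j : ι) :
    κ j (∑ i, d i • r i) = (d ᵥ* coordMatrix r κ) j := by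
  simp [Matrix.vecMul, dotProduct, coordMatrix]

variable [DecidableEq ι]

/-- The fraction-free reduction of `ρ` by the vectors `r i`, whose coordinates `κ j` vanish. -/
def reduce (r : ι → M) (κ : ι → M →ₗ[R] R) (ρ : M) : M :=
  (coordMatrix r κ).det • ρ - ∑ i, ((fun j => κ j ρ) ᵥ* (coordMatrix r κ).adjugate) i • r i

/-- The adjugate times the matrix is the determinant times the identity, so the subtracted
combination has the same coordinates as `det • ρ`. -/
theorem coord_reduce (r : ι → M) (κ : ι → M →ₗ[R] R) (ρ : M) (j : ι) :
    κ j (reduce r κ ρ) = 0 := by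
  rw [reduce, map_sub, coord_sum, Matrix.vecMul_vecMul, Matrix.adjugate_mul]
  simp [Matrix.vecMul_smul]

theorem reduce_eq_smul (r : ι → M) (κ : ι → M →ₗ[R] R) (ρ : M) (h : ∀ j, κ j ρ = 0) :
    reduce r κ ρ = (coordMatrix r κ).det • ρ := by
  have : (fun j => κ j ρ) = 0 := funext h
  simp [reduce, this]

theorem apply_reduce (r : ι → M) (κ : ι → M →ₗ[R] R) (l : M →ₗ[R] R) (ρ : M)
    (h : ∀ i, l (r i) = 0) : l (reduce r κ ρ) = (coordMatrix r κ).det * l ρ := by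
  simp [reduce, h]

theorem reduce_neg (r : ι → M) (κ : ι → M →ₗ[R] R) (ρ : M) :
    reduce r κ (-ρ) = - reduce r κ ρ := by
  have : (fun j => κ j (-ρ)) = -(fun j => κ j ρ) := by ext; simp
  simp only [reduce, this, Matrix.neg_vecMul, smul_neg, Pi.neg_apply, neg_smul,
    Finset.sum_neg_distrib]
  abel

/-- Reduction in terms of the reductions of a dual family. -/
theorem reduce_eq_sub_sum (r : ι → M) (κ : ι → M →ₗ[R] R) (e : ι → M)
    (he : ∀ i j, κ j (e i) = if i = j then 1 else 0) (ρ : M) :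
    reduce r κ ρ = (coordMatrix r κ).det • ρ -
      ∑ j, κ j ρ • ((coordMatrix r κ).det • e j - reduce r κ (e j)) := by
  have h1 : ∀ j, (coordMatrix r κ).det • e j - reduce r κ (e j) =
      ∑ i, (coordMatrix r κ).adjugate j i • r i := by
    intro j
    rw [reduce, sub_sub_cancel]
    refine Finset.sum_congr rfl fun i _ => ?_
    simp [Matrix.vecMul, dotProduct, he]
  simp only [h1]
  simp only [reduce, Finset.smul_sum, Matrix.vecMul, dotProduct, Finset.sum_smul, smul_smul]
  rw [Finset.sum_comm]

/-- A Schur complement without denominators: multiplying on the right by a block triangular matrix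
of determinant `A.det` clears the upper right block and leaves `κ' (reduce r κ r')` in the corner.
Hence the coefficient of the pivot variable is the next determinant. -/
theorem det_coordMatrix_sum [NoZeroDivisors R] (r : ι → M) (κ : ι → M →ₗ[R] R) (r' : M)
    (κ' : M →ₗ[R] R) (h0 : (coordMatrix r κ).det ≠ 0) :
    (coordMatrix (Sum.elim r fun _ : Unit => r') (Sum.elim κ fun _ => κ')).det =
      κ' (reduce r κ r') := by
  set A := coordMatrix r κ with hA
  have hM : coordMatrix (Sum.elim r fun _ : Unit => r') (Sum.elim κ fun _ => κ') =
      Matrix.fromBlocks A (Matrix.of fun i _ => κ' (r i)) (Matrix.of fun _ j => κ j r')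
        (Matrix.of fun _ _ => κ' r') := by
    ext (i | i) (j | j) <;> simp [coordMatrix, hA]
  have key : (coordMatrix (Sum.elim r fun _ : Unit => r') (Sum.elim κ fun _ => κ')) *
      Matrix.fromBlocks 1 (-(A.adjugate * Matrix.of fun i (_ : Unit) => κ' (r i))) 0
        (A.det • (1 : Matrix Unit Unit R)) =
      Matrix.fromBlocks A 0 (Matrix.of fun _ j => κ j r')
        (Matrix.of fun _ _ => κ' (reduce r κ r')) := by
    rw [hM, Matrix.fromBlocks_multiply]
    congr 1
    · simp
    · rw [Matrix.mul_neg, ← Matrix.mul_assoc, Matrix.mul_adjugate]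
      simp
    · simp
    · rw [Matrix.mul_neg, ← Matrix.mul_assoc]
      ext i j
      simp [reduce, ← hA, Matrix.mul_apply, Matrix.vecMul, dotProduct]
      ring
  have := congrArg Matrix.det key
  rw [Matrix.det_mul, Matrix.det_fromBlocks_zero₂₁, Matrix.det_fromBlocks_zero₁₂] at this
  simp only [Matrix.det_one, one_mul, Matrix.det_unique, Matrix.of_apply, Matrix.smul_apply,
    Matrix.one_apply_eq, smul_eq_mul, mul_one] at this
  rw [mul_comm A.det] at this
  exact mul_right_cancel₀ h0 this

/-- The step of Bareiss' algorithm: the division by the previous pivot is exact. -/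
theorem smul_reduce_sum [IsDomain R] [Module.IsTorsionFree R M] (r : ι → M) (κ : ι → M →ₗ[R] R)
    (r' : M) (κ' : M →ₗ[R] R) (h0 : (coordMatrix r κ).det ≠ 0) (h1 : κ' (reduce r κ r') ≠ 0)
    (ρ : M) :
    (coordMatrix r κ).det • reduce (Sum.elim r fun _ : Unit => r') (Sum.elim κ fun _ => κ') ρ =
      κ' (reduce r κ r') • reduce r κ ρ - κ' (reduce r κ ρ) • reduce r κ r' := by
  set R' := Sum.elim r fun _ : Unit => r' with hR'
  set K' := Sum.elim κ fun _ : Unit => κ' with hK'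
  have hdet := det_coordMatrix_sum r κ r' κ' h0
  set p := (coordMatrix r κ).det with hp
  set f := κ' (reduce r κ r') with hf
  set h := κ' (reduce r κ ρ) with hh
  set w' := (fun j => K' j ρ) ᵥ* (coordMatrix R' K').adjugate with hw'
  set w := (fun j => κ j ρ) ᵥ* (coordMatrix r κ).adjugate with hw
  set u := (fun j => κ j r') ᵥ* (coordMatrix r κ).adjugate with hu
  -- The multiples of `ρ` on the two sides cancel; `d` collects the remaining coefficients of the
  -- rows.
  let d : ι ⊕ Unit → R := Sum.elim (fun i => -(p * w' (Sum.inl i)) + f * w i - h * u i)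
    (fun _ => -(p * w' (Sum.inr ())) + h * p)
  have e1 : p • reduce R' K' ρ - (f • reduce r κ ρ - h • reduce r κ r') = ∑ i, d i • R' i := by
    rw [reduce, hdet, ← hw', reduce, ← hw, reduce, ← hu, ← hp]
    simp only [Fintype.sum_sum_type, d, Sum.elim_inl, Sum.elim_inr, hR', Finset.univ_unique,
      Finset.sum_singleton, PUnit.default_eq_unit, sub_smul, add_smul, neg_smul, mul_smul,
      Finset.sum_sub_distrib, Finset.sum_add_distrib, Finset.sum_neg_distrib, smul_sub,
      ← Finset.smul_sum, smul_add]
    rw [smul_comm p f ρ]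
    abel
  -- Both sides have vanishing coordinates: the old ones by reduction, the new one by
  -- cross-multiplication. As the enlarged matrix is nonsingular, `d` must be zero.
  have e2 : d ᵥ* coordMatrix R' K' = 0 := by
    ext j
    rw [← coord_sum, ← e1]
    simp only [map_sub, map_smul, coord_reduce]
    rcases j with j | j
    · simp [hK', coord_reduce]
    · simp only [hK', Sum.elim_inr, smul_eq_mul, mul_zero, zero_sub, Pi.zero_apply, neg_sub]
      rw [← hf, ← hh]; ring
  have e3 : d = 0 := Matrix.eq_zero_of_vecMul_eq_zero (by rw [hdet]; exact h1) e2
  rw [e3] at e1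
  simpa [sub_eq_zero] using e1

end Bareiss

/-! ### Terms -/

section Terms

variable {V : Type*}

/-- The value of a term, as a semilinear map. -/
noncomputable def LinTerm.evalHom (t : ℤ) (ν : V → ℤ) :
    LinTerm V →ₛₗ[Polynomial.evalRingHom t] ℤ where
  toFun := LinTerm.eval t ν
  map_add' σ τ := by
    simp only [LinTerm.eval, Prod.fst_add, Prod.snd_add, Polynomial.eval_add]
    rw [Finsupp.sum_add_index' (by simp) (by intros; simp [add_mul])]
    ring
  map_smul' f τ := by
    simp only [LinTerm.eval, Prod.smul_fst, Prod.smul_snd, smul_eq_mul, Polynomial.eval_mul,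
      Polynomial.coe_evalRingHom, mul_add]
    rw [Finsupp.sum_smul_index (by simp), Finsupp.mul_sum]
    simp [mul_assoc]

theorem LinTerm.eval_add (t : ℤ) (ν : V → ℤ) (σ τ : LinTerm V) :
    (σ + τ).eval t ν = σ.eval t ν + τ.eval t ν := map_add (LinTerm.evalHom t ν) σ τ

theorem LinTerm.eval_neg (t : ℤ) (ν : V → ℤ) (τ : LinTerm V) :
    (-τ).eval t ν = -τ.eval t ν := map_neg (LinTerm.evalHom t ν) τ

theorem LinTerm.eval_sub (t : ℤ) (ν : V → ℤ) (σ τ : LinTerm V) :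
    (σ - τ).eval t ν = σ.eval t ν - τ.eval t ν := map_sub (LinTerm.evalHom t ν) σ τ

theorem LinTerm.eval_smul (t : ℤ) (ν : V → ℤ) (f : ℤ[X]) (τ : LinTerm V) :
    (f • τ : LinTerm V).eval t ν = f.eval t * τ.eval t ν :=
  map_smulₛₗ (LinTerm.evalHom t ν) f τ

theorem LinTerm.eval_sum {ι : Type*} (t : ℤ) (ν : V → ℤ) (s : Finset ι) (τ : ι → LinTerm V) :
    (∑ i ∈ s, τ i).eval t ν = ∑ i ∈ s, (τ i).eval t ν := map_sum (LinTerm.evalHom t ν) τ s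

theorem LinTerm.eval_const (t : ℤ) (ν : V → ℤ) (f : ℤ[X]) :
    (LinTerm.const f : LinTerm V).eval t ν = f.eval t := by
  simp [LinTerm.eval, LinTerm.const]

theorem LinTerm.eval_single (t : ℤ) (ν : V → ℤ) (v : V) (f : ℤ[X]) :
    LinTerm.eval t ν (0, Finsupp.single v f) = f.eval t * ν v := by
  simp [LinTerm.eval]

theorem LinTerm.eval_congr (t : ℤ) {ν ν' : V → ℤ} (τ : LinTerm V)
    (h : ∀ v, τ.2 v ≠ 0 → ν v = ν' v) : τ.eval t ν = τ.eval t ν' := by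
  unfold LinTerm.eval
  congr 1
  exact Finsupp.sum_congr fun v hv => by rw [h v (by simpa using hv)]

/-- The direction `d` may have infinite support; `s` only has to contain the variables that both
occur in `τ` and move. -/
theorem LinTerm.eval_shift (t : ℤ) (ν d : V → ℤ) (δ : ℤ) (τ : LinTerm V) (s : Finset V)
    (hs : ∀ v, v ∉ s → τ.2 v = 0 ∨ d v = 0) :
    τ.eval t (fun v => ν v + δ * d v) =
      τ.eval t ν + δ * ∑ v ∈ s, (τ.2 v).eval t * d v := by
  classical
  have : ∑ v ∈ s, (τ.2 v).eval t * d v = τ.2.sum fun v f => f.eval t * d v := by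
    rw [Finsupp.sum_of_support_subset _ (Finset.subset_union_left (s₂ := s)) _ (by simp)]
    refine Finset.sum_subset Finset.subset_union_right fun v _ hv => ?_
    rcases hs v hv with h | h <;> simp [h]
  rw [this]
  unfold LinTerm.eval
  rw [add_assoc, Finsupp.mul_sum, ← Finsupp.sum_add]
  congr 1
  exact Finsupp.sum_congr fun v _ => by ring

/-- The coefficient of a variable. -/
noncomputable def LinTerm.coeff (v : V) : LinTerm V →ₗ[ℤ[X]] ℤ[X] :=
  Finsupp.lapply v ∘ₗ LinearMap.snd ℤ[X] ℤ[X] (V →₀ ℤ[X])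

theorem LinTerm.erase_eq_sub (v : V) (τ : LinTerm V) :
    τ.erase v = τ - τ.2 v • ((0, Finsupp.single v 1) : LinTerm V) := by
  classical
  refine Prod.ext (by simp [LinTerm.erase]) ?_
  ext u
  by_cases h : u = v
  · subst h; simp [LinTerm.erase]
  · simp [LinTerm.erase, Finsupp.erase_ne h, Ne.symm h]

theorem LinTerm.erase_apply_ne {v u : V} (h : u ≠ v) (τ : LinTerm V) :
    (τ.erase v).2 u = τ.2 u := by
  simp [LinTerm.erase, Finsupp.erase_ne h]

/-- The two `x`-summands cancel, so a vigorous substitution is a cross-multiplication of rows as in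
Gaussian elimination. -/
theorem LinTerm.vigSub_eq (x : V) (η ρ : LinTerm V) :
    LinTerm.vigSub (η.2 x) (η.erase x) x ρ = η.2 x • ρ - ρ.2 x • η := by
  rw [LinTerm.vigSub, LinTerm.erase_eq_sub, LinTerm.erase_eq_sub]
  module

theorem exactDiv_mul {p : ℤ[X]} (hp : p ≠ 0) (f : ℤ[X]) : exactDiv p (p * f) = f := by
  have h : p ≠ 0 ∧ p ∣ p * f := ⟨hp, dvd_mul_right _ _⟩
  rw [exactDiv, dif_pos h]
  exact (mul_left_cancel₀ hp (Classical.choose_spec h.2)).symm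

theorem LinTerm.divBy_smul {p : ℤ[X]} (hp : p ≠ 0) (τ : LinTerm V) :
    (p • τ : LinTerm V).divBy p = τ := by
  refine Prod.ext (exactDiv_mul hp _) ?_
  ext1 v
  simp [LinTerm.divBy, exactDiv_mul hp]

theorem LinTerm.divisibleBy_smul (p : ℤ[X]) (τ : LinTerm V) : (p • τ : LinTerm V).DivisibleBy p :=
  ⟨dvd_mul_right _ _, fun _ => dvd_mul_right _ _⟩

end Terms

/-! ### Positive Boolean combinations -/

section PosBool

variable {A B D : Type*}

/-- Positivity is used here: a step has to preserve only the atoms that are true, whatever happens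
to the false ones. -/
theorem PosBool.holds_mono {p q : A → Prop} {φ : PosBool A} (h : ∀ a ∈ φ.atoms, p a → q a)
    (hp : φ.Holds p) : φ.Holds q := by
  induction φ with
  | atom a => exact h a (by simp [PosBool.atoms]) hp
  | and φ ψ ih1 ih2 =>
    simp only [PosBool.atoms, List.mem_append] at h
    exact ⟨ih1 (fun a ha => h a (.inl ha)) hp.1, ih2 (fun a ha => h a (.inr ha)) hp.2⟩
  | or φ ψ ih1 ih2 =>
    simp only [PosBool.atoms, List.mem_append] at h
    exact hp.imp (ih1 (fun a ha => h a (.inl ha))) (ih2 (fun a ha => h a (.inr ha)))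

theorem PosBool.holds_map (f : A → B) (p : B → Prop) (φ : PosBool A) :
    (φ.map f).Holds p ↔ φ.Holds (p ∘ f) := by
  induction φ with
  | atom a => rfl
  | and φ ψ ih1 ih2 => exact and_congr ih1 ih2
  | or φ ψ ih1 ih2 => exact or_congr ih1 ih2

theorem PosBool.mem_atoms_map (f : A → B) (φ : PosBool A) (b : B) :
    b ∈ (φ.map f).atoms ↔ ∃ a ∈ φ.atoms, f a = b := by
  induction φ with
  | atom a => simp [PosBool.atoms, PosBool.map, eq_comm]
  | and φ ψ ih1 ih2 => simp [PosBool.atoms, PosBool.map, ih1, ih2, or_and_right, exists_or]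
  | or φ ψ ih1 ih2 => simp [PosBool.atoms, PosBool.map, ih1, ih2, or_and_right, exists_or]

theorem PosBool.map_map (f : A → B) (g : B → D) (φ : PosBool A) :
    (φ.map f).map g = φ.map (g ∘ f) := by
  induction φ with
  | atom a => rfl
  | and φ ψ ih1 ih2 => simp [PosBool.map, ih1, ih2]
  | or φ ψ ih1 ih2 => simp [PosBool.map, ih1, ih2]

theorem PosBool.map_congr {f g : A → B} {φ : PosBool A} (h : ∀ a ∈ φ.atoms, f a = g a) :
    φ.map f = φ.map g := by
  induction φ with
  | atom a => simp [PosBool.map, h a (by simp [PosBool.atoms])]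
  | and φ ψ ih1 ih2 =>
    simp only [PosBool.atoms, List.mem_append] at h
    rw [PosBool.map, PosBool.map, ih1 fun a ha => h a (.inl ha), ih2 fun a ha => h a (.inr ha)]
  | or φ ψ ih1 ih2 =>
    simp only [PosBool.atoms, List.mem_append] at h
    rw [PosBool.map, PosBool.map, ih1 fun a ha => h a (.inl ha), ih2 fun a ha => h a (.inr ha)]

theorem PosBool.map_id' (φ : PosBool A) : φ.map (fun a => a) = φ := by
  induction φ with
  | atom a => rfl
  | and φ ψ ih1 ih2 => simp [PosBool.map, ih1, ih2]
  | or φ ψ ih1 ih2 => simp [PosBool.map, ih1, ih2]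

end PosBool

/-! ### Atoms, variables and satisfaction of formulae -/

section Formulas

variable {V : Type*}

theorem Constraint.holds_congr (t : ℤ) {ν ν' : V → ℤ} (c : Constraint V)
    (h : ∀ v, c.term.2 v ≠ 0 → ν v = ν' v) : c.Holds t ν ↔ c.Holds t ν' := by
  have := LinTerm.eval_congr t _ h
  cases c <;> simp only [Constraint.Holds] <;> simp only [Constraint.term] at this <;> rw [this]

theorem Formula.sat_congr (t : ℤ) {ν ν' : V → ℤ} {φ : Formula V}
    (h : ∀ v ∈ φ.vars, ν v = ν' v) (hs : φ.Sat t ν) : φ.Sat t ν' :=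
  PosBool.holds_mono
    (fun c hc => (Constraint.holds_congr t c fun v hv => h v ⟨c, hc, hv⟩).1) hs

theorem Formula.sat_pos (t : ℤ) (ν : V → ℤ) (f : ℤ[X]) :
    (Formula.pos f : Formula V).Sat t ν ↔ 0 < f.eval t := by
  simp only [Formula.Sat, Formula.pos, PosBool.Holds, Constraint.Holds, LinTerm.eval_const]
  simp only [Polynomial.eval_add, Polynomial.eval_sub, Polynomial.eval_zero, Polynomial.eval_one]
  omega

theorem Formula.vars_pos (f : ℤ[X]) : (Formula.pos f : Formula V).vars = ∅ := by
  ext v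
  simp [Formula.vars, Formula.pos, PosBool.atoms, Constraint.term, LinTerm.const]

theorem Formula.vars_and (φ ψ : Formula V) :
    Formula.vars (.and φ ψ) = φ.vars ∪ ψ.vars := by
  ext v
  simp [Formula.vars, PosBool.atoms, or_and_right, exists_or]

theorem Formula.mem_divisors (φ : Formula V) (f : ℤ[X]) :
    f ∈ φ.divisors ↔ ∃ τ, Constraint.dvd f τ ∈ φ.atoms := by
  simp only [Formula.divisors, List.mem_filterMap]
  constructor
  · rintro ⟨c, hc, h⟩
    cases c <;> simp at h
    subst h; exact ⟨_, hc⟩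
  · rintro ⟨τ, h⟩
    exact ⟨_, h, rfl⟩

theorem Formula.mem_equalities (φ : Formula V) (η : LinTerm V) :
    η ∈ φ.equalities ↔ Constraint.eq η ∈ φ.atoms := by
  simp only [Formula.equalities, List.mem_filterMap]
  constructor
  · rintro ⟨c, hc, h⟩
    cases c <;> simp at h
    subst h; exact hc
  · intro h
    exact ⟨_, h, rfl⟩

end Formulas

/-! ### Slack variables and vanishing divisors -/

section Slack

variable {V : Type*}

theorem LinTerm.lift_apply_inl (τ : LinTerm V) (v : V) : τ.lift.2 (Sum.inl v) = τ.2 v :=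
  Finsupp.mapDomain_apply Sum.inl_injective _ _

theorem LinTerm.lift_apply_inr (τ : LinTerm V) (k : ℕ) : τ.lift.2 (Sum.inr k) = 0 :=
  Finsupp.mapDomain_of_notMem_range _ _ (by simp)

theorem LinTerm.eval_lift (t : ℤ) (ν : V ⊕ ℕ → ℤ) (τ : LinTerm V) :
    τ.lift.eval t ν = τ.eval t fun v => ν (Sum.inl v) := by
  simp only [LinTerm.eval, LinTerm.lift]
  rw [Finsupp.sum_mapDomain_index (by simp) (by intros; simp [add_mul])]

/-- The slack variable with index `k`, as a term. -/
noncomputable def slackTerm (V : Type*) (k : ℕ) : LinTerm (V ⊕ ℕ) :=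
  (0, Finsupp.single (Sum.inr k) 1)

theorem slackTerm_apply_inl (k : ℕ) (v : V) : (slackTerm V k).2 (Sum.inl v) = 0 := by
  simp [slackTerm]

theorem slackTerm_apply_inr (k j : ℕ) :
    (slackTerm V k).2 (Sum.inr j) = if k = j then 1 else 0 := by
  classical
  rw [slackTerm, Finsupp.single_apply]
  simp

theorem slackTerm_eval (t : ℤ) (ν : V ⊕ ℕ → ℤ) (k : ℕ) :
    (slackTerm V k).eval t ν = ν (Sum.inr k) := by
  simp [slackTerm, LinTerm.eval_single]

theorem lift_add_slackTerm_apply_inr (τ : LinTerm V) (k j : ℕ) :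
    (τ.lift + slackTerm V k).2 (Sum.inr j) = if k = j then 1 else 0 := by
  simp [LinTerm.lift_apply_inr, slackTerm_apply_inr]

theorem mem_atoms_addSlack {φ : Formula V} {k : ℕ} {a : Constraint (V ⊕ ℕ)}
    (h : a ∈ (addSlack φ k).atoms) :
    (∃ τ, .eq τ ∈ φ.atoms ∧ a = .eq τ.lift) ∨
    (∃ τ j, .le τ ∈ φ.atoms ∧ k ≤ j ∧ j < k + numLe φ ∧ a = .eq (τ.lift + slackTerm V j)) ∨
    (∃ f τ, .dvd f τ ∈ φ.atoms ∧ a = .dvd f τ.lift) := by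
  induction φ generalizing k with
  | atom c =>
    cases c with
    | eq τ => left; simpa [addSlack, PosBool.atoms] using h
    | le τ =>
      right; left
      exact ⟨τ, k, by simp [PosBool.atoms], le_rfl, by simp [numLe],
        by simpa [addSlack, PosBool.atoms, slackTerm] using h⟩
    | dvd f τ =>
      right; right
      exact ⟨f, τ, by simp [PosBool.atoms], by simpa [addSlack, PosBool.atoms] using h⟩
  | and φ ψ ih1 ih2 =>
    simp only [addSlack, PosBool.atoms, List.mem_append, numLe] at h ⊢
    rcases h with h | h
    · rcases ih1 h with ⟨τ, h1, h2⟩ | ⟨τ, j, h1, h2, h3, h4⟩ | ⟨f, τ, h1, h2⟩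
      · exact .inl ⟨τ, .inl h1, h2⟩
      · exact .inr (.inl ⟨τ, j, .inl h1, h2, by omega, h4⟩)
      · exact .inr (.inr ⟨f, τ, .inl h1, h2⟩)
    · rcases ih2 h with ⟨τ, h1, h2⟩ | ⟨τ, j, h1, h2, h3, h4⟩ | ⟨f, τ, h1, h2⟩
      · exact .inl ⟨τ, .inr h1, h2⟩
      · exact .inr (.inl ⟨τ, j, .inr h1, by omega, by omega, h4⟩)
      · exact .inr (.inr ⟨f, τ, .inr h1, h2⟩)
  | or φ ψ ih1 ih2 =>
    simp only [addSlack, PosBool.atoms, List.mem_append, numLe] at h ⊢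
    rcases h with h | h
    · rcases ih1 h with ⟨τ, h1, h2⟩ | ⟨τ, j, h1, h2, h3, h4⟩ | ⟨f, τ, h1, h2⟩
      · exact .inl ⟨τ, .inl h1, h2⟩
      · exact .inr (.inl ⟨τ, j, .inl h1, h2, by omega, h4⟩)
      · exact .inr (.inr ⟨f, τ, .inl h1, h2⟩)
    · rcases ih2 h with ⟨τ, h1, h2⟩ | ⟨τ, j, h1, h2, h3, h4⟩ | ⟨f, τ, h1, h2⟩
      · exact .inl ⟨τ, .inr h1, h2⟩
      · exact .inr (.inl ⟨τ, j, .inr h1, by omega, by omega, h4⟩)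
      · exact .inr (.inr ⟨f, τ, .inr h1, h2⟩)

theorem not_le_mem_addSlack {φ : Formula V} {k : ℕ} {ρ : LinTerm (V ⊕ ℕ)} :
    Constraint.le ρ ∉ (addSlack φ k).atoms := by
  intro h
  rcases mem_atoms_addSlack h with ⟨τ, -, h⟩ | ⟨τ, j, -, -, -, h⟩ | ⟨f, τ, -, h⟩ <;> simp at h

theorem dvd_mem_addSlack {φ : Formula V} {k : ℕ} {g : ℤ[X]} {ρ : LinTerm (V ⊕ ℕ)}
    (h : Constraint.dvd g ρ ∈ (addSlack φ k).atoms) :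
    g ∈ φ.divisors ∧ ∀ j, ρ.2 (Sum.inr j) = 0 := by
  rcases mem_atoms_addSlack h with ⟨τ, -, h⟩ | ⟨τ, j, -, -, -, h⟩ | ⟨f, τ, h1, h⟩ <;> simp at h
  obtain ⟨rfl, rfl⟩ := h
  exact ⟨(Formula.mem_divisors _ _).2 ⟨_, h1⟩, fun j => LinTerm.lift_apply_inr _ _⟩

theorem eq_mem_addSlack {φ : Formula V} {k : ℕ} {ρ : LinTerm (V ⊕ ℕ)} {j : ℕ}
    (h : Constraint.eq ρ ∈ (addSlack φ k).atoms) (hj : ρ.2 (Sum.inr j) ≠ 0) :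
    ∃ τ : LinTerm V, k ≤ j ∧ j < k + numLe φ ∧ ρ = τ.lift + slackTerm V j := by
  rcases mem_atoms_addSlack h with ⟨τ, -, h⟩ | ⟨τ, i, -, h1, h2, h⟩ | ⟨f, τ, h1, h⟩ <;> simp at h
  · subst h; exact absurd (LinTerm.lift_apply_inr _ _) hj
  · subst h
    rw [lift_add_slackTerm_apply_inr] at hj
    obtain rfl : i = j := by simpa using hj
    exact ⟨τ, h1, h2, rfl⟩

theorem vars_addSlack {φ : Formula V} {k : ℕ} {a : Constraint (V ⊕ ℕ)}
    (h : a ∈ (addSlack φ k).atoms) {z : V} (hz : a.term.2 (Sum.inl z) ≠ 0) : z ∈ φ.vars := by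
  rcases mem_atoms_addSlack h with ⟨τ, h1, rfl⟩ | ⟨τ, j, h1, -, -, rfl⟩ | ⟨f, τ, h1, rfl⟩ <;>
    refine ⟨_, h1, ?_⟩ <;>
    simpa [Constraint.term, LinTerm.lift_apply_inl, slackTerm_apply_inl] using hz

/-- The two parts of a conjunction or disjunction use disjoint intervals of indices, so a slack
variable determines its equality. -/
theorem eq_of_mem_addSlack {φ : Formula V} {k : ℕ} {ρ ρ' : LinTerm (V ⊕ ℕ)} {j : ℕ}
    (h : Constraint.eq ρ ∈ (addSlack φ k).atoms) (h' : Constraint.eq ρ' ∈ (addSlack φ k).atoms)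
    (hj : ρ.2 (Sum.inr j) ≠ 0) (hj' : ρ'.2 (Sum.inr j) ≠ 0) : ρ = ρ' := by
  induction φ generalizing k with
  | atom c => cases c <;> simp [addSlack, PosBool.atoms] at h h' <;> rw [h, h']
  | and φ ψ ih1 ih2 =>
    simp only [addSlack, PosBool.atoms, List.mem_append] at h h'
    rcases h with h | h <;> rcases h' with h' | h'
    · exact ih1 h h'
    · obtain ⟨_, h1, h2, _⟩ := eq_mem_addSlack h hj
      obtain ⟨_, h3, h4, _⟩ := eq_mem_addSlack h' hj'
      omega
    · obtain ⟨_, h1, h2, _⟩ := eq_mem_addSlack h hj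
      obtain ⟨_, h3, h4, _⟩ := eq_mem_addSlack h' hj'
      omega
    · exact ih2 h h'
  | or φ ψ ih1 ih2 =>
    simp only [addSlack, PosBool.atoms, List.mem_append] at h h'
    rcases h with h | h <;> rcases h' with h' | h'
    · exact ih1 h h'
    · obtain ⟨_, h1, h2, _⟩ := eq_mem_addSlack h hj
      obtain ⟨_, h3, h4, _⟩ := eq_mem_addSlack h' hj'
      omega
    · obtain ⟨_, h1, h2, _⟩ := eq_mem_addSlack h hj
      obtain ⟨_, h3, h4, _⟩ := eq_mem_addSlack h' hj'
      omega
    · exact ih2 h h'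

/-- The predicates are arbitrary so that `P` can be truth after elimination and removal of slack
variables. -/
theorem holds_of_addSlack {P : Constraint (V ⊕ ℕ) → Prop} {Q : Constraint V → Prop}
    (heq : ∀ τ, P (.eq τ.lift) → Q (.eq τ))
    (hle : ∀ τ j, P (.eq (τ.lift + slackTerm V j)) → Q (.le τ))
    (hdvd : ∀ f τ, P (.dvd f τ.lift) → Q (.dvd f τ)) {φ : Formula V} {k : ℕ}
    (h : (addSlack φ k).Holds P) : φ.Holds Q := by
  induction φ generalizing k with
  | atom c =>
    cases c with
    | eq τ => exact heq τ h
    | le τ => exact hle τ k h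
    | dvd f τ => exact hdvd f τ h
  | and φ ψ ih1 ih2 => exact ⟨ih1 h.1, ih2 h.2⟩
  | or φ ψ ih1 ih2 => exact h.imp ih1 ih2

theorem addSlack_holds {P : Constraint (V ⊕ ℕ) → Prop} {Q : Constraint V → Prop}
    {φ : Formula V} {k : ℕ} (heq : ∀ τ, Q (.eq τ) → P (.eq τ.lift))
    (hle : ∀ τ j, Constraint.eq (τ.lift + slackTerm V j) ∈ (addSlack φ k).atoms →
      Q (.le τ) → P (.eq (τ.lift + slackTerm V j)))
    (hdvd : ∀ f τ, Q (.dvd f τ) → P (.dvd f τ.lift))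
    (h : φ.Holds Q) : (addSlack φ k).Holds P := by
  induction φ generalizing k with
  | atom c =>
    cases c with
    | eq τ => exact heq τ h
    | le τ => exact hle τ k (by simp [addSlack, PosBool.atoms, slackTerm]) h
    | dvd f τ => exact hdvd f τ h
  | and φ ψ ih1 ih2 =>
    simp only [addSlack, PosBool.atoms, List.mem_append] at hle
    exact ⟨ih1 (fun τ j hj => hle τ j (.inl hj)) h.1, ih2 (fun τ j hj => hle τ j (.inr hj)) h.2⟩
  | or φ ψ ih1 ih2 =>
    simp only [addSlack, PosBool.atoms, List.mem_append] at hle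
    exact h.imp (ih1 fun τ j hj => hle τ j (.inl hj)) (ih2 fun τ j hj => hle τ j (.inr hj))

/-- A solution of a formula extends to a solution with nonnegative slack variables. -/
theorem exists_addSlack_sat {t : ℤ} {ν : V → ℤ} {φ : Formula V} (h : φ.Sat t ν) :
    ∃ ν' : V ⊕ ℕ → ℤ, (∀ v, ν' (Sum.inl v) = ν v) ∧ (∀ k, 0 ≤ ν' (Sum.inr k)) ∧
      (addSlack φ 0).Sat t ν' := by
  classical
  -- The truncation at `0` is for inequalities that are false at `ν`: their slack variables have to
  -- be nonnegative as well.
  have hs : ∀ j : ℕ, ∃ s : ℤ, 0 ≤ s ∧ ∀ τ : LinTerm V,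
      Constraint.eq (τ.lift + slackTerm V j) ∈ (addSlack φ 0).atoms → s = max 0 (-τ.eval t ν) := by
    intro j
    by_cases hj : ∃ τ : LinTerm V, Constraint.eq (τ.lift + slackTerm V j) ∈ (addSlack φ 0).atoms
    · obtain ⟨τ, hτ⟩ := hj
      refine ⟨max 0 (-τ.eval t ν), le_max_left _ _, fun τ' hτ' => ?_⟩
      have := eq_of_mem_addSlack (j := j) hτ hτ' (by rw [lift_add_slackTerm_apply_inr]; simp)
        (by rw [lift_add_slackTerm_apply_inr]; simp)
      have := congrArg (LinTerm.eval t (Sum.elim ν fun _ => 0)) (add_right_cancel this)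
      simp only [LinTerm.eval_lift, Sum.elim_inl] at this
      rw [this]
    · push Not at hj
      exact ⟨0, le_rfl, fun τ hτ => absurd hτ (hj τ)⟩
  choose s hs0 hs1 using hs
  refine ⟨Sum.elim ν s, fun _ => rfl, hs0, addSlack_holds (fun τ hτ => ?_) (fun τ j hj hτ => ?_)
    (fun f τ hτ => ?_) h⟩
  · simpa [Constraint.Holds, LinTerm.eval_lift] using hτ
  · simp only [Constraint.Holds, LinTerm.eval_add, LinTerm.eval_lift, slackTerm_eval,
      Sum.elim_inl, Sum.elim_inr, hs1 j τ hj] at hτ ⊢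
    have : max 0 (-τ.eval t ν) = -τ.eval t ν := max_eq_right (by omega)
    rw [this]; exact add_neg_cancel _
  · simpa [Constraint.Holds, LinTerm.eval_lift] using hτ

open Classical in
/-- Replace `f(t) ∣ τ` by `τ = 0` if `f ∈ Z`. -/
noncomputable def Constraint.zeroDivisor (Z : List ℤ[X]) : Constraint V → Constraint V
  | .dvd f τ => if f ∈ Z then .eq τ else .dvd f τ
  | c => c

theorem zeroDivisors_eq (Z : List ℤ[X]) (φ : Formula V) :
    zeroDivisors Z φ = Z.foldl (fun ψ f => ψ.and (.atom (.eq (LinTerm.const f))))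
      (φ.map (Constraint.zeroDivisor Z)) := by
  unfold zeroDivisors
  congr 2

theorem holds_foldl_and {A B : Type*} (p : A → Prop) (g : B → A) (Z : List B) (φ : PosBool A) :
    (Z.foldl (fun ψ f => ψ.and (.atom (g f))) φ).Holds p ↔ φ.Holds p ∧ ∀ f ∈ Z, p (g f) := by
  induction Z generalizing φ with
  | nil => simp
  | cons f Z ih => simp [ih, PosBool.Holds, and_assoc]

theorem mem_atoms_foldl_and {A B : Type*} (g : B → A) (Z : List B) (φ : PosBool A) (a : A) :
    a ∈ (Z.foldl (fun ψ f => ψ.and (.atom (g f))) φ).atoms ↔ a ∈ φ.atoms ∨ ∃ f ∈ Z, a = g f := by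
  induction Z generalizing φ with
  | nil => simp
  | cons f Z ih => simp [ih, PosBool.atoms, or_assoc]

/-- Divisibility by `0` is equality to `0`, so the replacement changes no truth value once all
members of `Z` vanish at `t`. -/
theorem zeroDivisors_sat (Z : List ℤ[X]) (φ : Formula V) (t : ℤ) (ν : V → ℤ) :
    (zeroDivisors Z φ).Sat t ν ↔ φ.Sat t ν ∧ ∀ f ∈ Z, f.eval t = 0 := by
  rw [Formula.Sat, zeroDivisors_eq, holds_foldl_and]
  simp only [Constraint.Holds, LinTerm.eval_const]
  refine and_congr_left fun hZ => ?_
  rw [PosBool.holds_map]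
  have : Constraint.Holds t ν ∘ Constraint.zeroDivisor Z = Constraint.Holds t ν := by
    funext c
    cases c with
    | dvd f τ =>
      by_cases hf : f ∈ Z
      · simp [Constraint.zeroDivisor, hf, Constraint.Holds, hZ f hf]
      · simp [Constraint.zeroDivisor, hf]
    | _ => rfl
  rw [this]; rfl

theorem vars_zeroDivisors (Z : List ℤ[X]) (φ : Formula V) : (zeroDivisors Z φ).vars ⊆ φ.vars := by
  rintro v ⟨c, hc, hv⟩
  rw [zeroDivisors_eq, mem_atoms_foldl_and, PosBool.mem_atoms_map] at hc
  rcases hc with ⟨a, ha, rfl⟩ | ⟨f, hf, rfl⟩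
  · refine ⟨a, ha, ?_⟩
    cases a with
    | dvd f τ => by_cases hf : f ∈ Z <;> simpa [Constraint.zeroDivisor, hf, Constraint.term] using hv
    | _ => exact hv
  · simp [Constraint.term, LinTerm.const] at hv

theorem divisors_zeroDivisors {Z : List ℤ[X]} {φ : Formula V} {f : ℤ[X]}
    (h : f ∈ (zeroDivisors Z φ).divisors) : f ∈ φ.divisors ∧ f ∉ Z := by
  obtain ⟨τ, hτ⟩ := (Formula.mem_divisors _ _).1 h
  rw [zeroDivisors_eq, mem_atoms_foldl_and, PosBool.mem_atoms_map] at hτ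
  rcases hτ with ⟨a, ha, e⟩ | ⟨g, hg, e⟩
  · cases a with
    | dvd g σ =>
      by_cases hg : g ∈ Z
      · simp [Constraint.zeroDivisor, hg] at e
      · simp only [Constraint.zeroDivisor, hg, if_false, Constraint.dvd.injEq] at e
        obtain ⟨rfl, rfl⟩ := e
        exact ⟨(Formula.mem_divisors _ _).2 ⟨_, ha⟩, hg⟩
    | _ => simp [Constraint.zeroDivisor] at e
  · simp at e

end Slack

/-! ### The invariant of the main loop -/

section Elim

variable {V ι : Type*}

/-- The variable `v`, as a term. -/
noncomputable def varTerm (v : V) : LinTerm (V ⊕ ℕ) := (0, Finsupp.single (Sum.inl v) 1)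

theorem varTerm_apply_inl (v : V) : (varTerm v).2 (Sum.inl v) = 1 := by simp [varTerm]

theorem varTerm_apply_inr (v : V) (k : ℕ) : (varTerm v).2 (Sum.inr k) = 0 := by simp [varTerm]

theorem varTerm_apply_ne {v u : V} (h : v ≠ u) : (varTerm v).2 (Sum.inl u) = 0 := by
  simp [varTerm, h.symm]

theorem varTerm_eval (t : ℤ) (ν : V ⊕ ℕ → ℤ) (v : V) :
    (varTerm v).eval t ν = ν (Sum.inl v) := by
  simp [varTerm, LinTerm.eval_single]

/-- The coefficients of the variables `c j`. -/
noncomputable def colCoeff (c : ι → V) (j : ι) : LinTerm (V ⊕ ℕ) →ₗ[ℤ[X]] ℤ[X] :=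
  LinTerm.coeff (Sum.inl (c j))

theorem colCoeff_apply (c : ι → V) (j : ι) (ρ : LinTerm (V ⊕ ℕ)) :
    colCoeff c j ρ = ρ.2 (Sum.inl (c j)) := rfl

theorem colCoeff_sum (c : ι → V) (x : V) :
    colCoeff (Sum.elim c fun _ : Unit => x) =
      Sum.elim (colCoeff c) fun _ => LinTerm.coeff (Sum.inl x) := by
  funext j; rcases j with j | j <;> rfl

variable [Fintype ι] [DecidableEq ι]

/-- The determinant of the coefficients of the variables `c j` in the terms `r i`. -/
noncomputable def elimDet (r : ι → LinTerm (V ⊕ ℕ)) (c : ι → V) : ℤ[X] :=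
  (coordMatrix r (colCoeff c)).det

/-- The fraction-free elimination of the variables `c j` with the equalities `r i = 0`. -/
noncomputable def elimTerm (r : ι → LinTerm (V ⊕ ℕ)) (c : ι → V) (ρ : LinTerm (V ⊕ ℕ)) :
    LinTerm (V ⊕ ℕ) := reduce r (colCoeff c) ρ

/-- The fraction-free elimination of the variables `c j` from a constraint. -/
noncomputable def elimConstraint (r : ι → LinTerm (V ⊕ ℕ)) (c : ι → V) :
    Constraint (V ⊕ ℕ) → Constraint (V ⊕ ℕ)
  | .eq ρ => .eq (elimTerm r c ρ)
  | .le ρ => .le ρ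
  | .dvd g ρ => .dvd (elimDet r c * g) (elimTerm r c ρ)

theorem elimTerm_apply_col (r : ι → LinTerm (V ⊕ ℕ)) (c : ι → V) (ρ : LinTerm (V ⊕ ℕ)) (j : ι) :
    (elimTerm r c ρ).2 (Sum.inl (c j)) = 0 := coord_reduce r (colCoeff c) ρ j

theorem elimTerm_apply (r : ι → LinTerm (V ⊕ ℕ)) (c : ι → V) (ρ : LinTerm (V ⊕ ℕ)) (v : V ⊕ ℕ)
    (h : ∀ i, (r i).2 v = 0) : (elimTerm r c ρ).2 v = elimDet r c * ρ.2 v :=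
  apply_reduce r (colCoeff c) (LinTerm.coeff v) ρ h

theorem smul_elimTerm_sum {r : ι → LinTerm (V ⊕ ℕ)} {c : ι → V} (h0 : elimDet r c ≠ 0)
    {r' : LinTerm (V ⊕ ℕ)} {x : V} (h1 : (elimTerm r c r').2 (Sum.inl x) ≠ 0)
    (ρ : LinTerm (V ⊕ ℕ)) :
    elimDet r c • elimTerm (Sum.elim r fun _ : Unit => r') (Sum.elim c fun _ => x) ρ =
      (elimTerm r c r').2 (Sum.inl x) • elimTerm r c ρ -
        (elimTerm r c ρ).2 (Sum.inl x) • elimTerm r c r' := by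
  have := smul_reduce_sum r (colCoeff c) r' (LinTerm.coeff (Sum.inl x)) h0 h1 ρ
  rw [← colCoeff_sum] at this
  exact this

theorem elimDet_sum {r : ι → LinTerm (V ⊕ ℕ)} {c : ι → V} (h0 : elimDet r c ≠ 0)
    (r' : LinTerm (V ⊕ ℕ)) (x : V) :
    elimDet (Sum.elim r fun _ : Unit => r') (Sum.elim c fun _ => x) =
      (elimTerm r c r').2 (Sum.inl x) := by
  have := det_coordMatrix_sum r (colCoeff c) r' (LinTerm.coeff (Sum.inl x)) h0
  rw [← colCoeff_sum] at this
  exact this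

/-- The substituted term is the cross-multiplication of two reduced rows, hence the old determinant
times the new reduction; in a divisor, the old determinant is already a factor. -/
theorem vigSub_elimConstraint {r : ι → LinTerm (V ⊕ ℕ)} {c : ι → V} (h0 : elimDet r c ≠ 0)
    {r' : LinTerm (V ⊕ ℕ)} {x : V} (h1 : (elimTerm r c r').2 (Sum.inl x) ≠ 0)
    (a : Constraint (V ⊕ ℕ)) :
    (elimConstraint r c a).vigSub ((elimTerm r c r').2 (Sum.inl x))
      ((elimTerm r c r').erase (Sum.inl x)) (Sum.inl x) =
    match a with
    | .eq ρ => .eq (elimDet r c •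
        elimTerm (Sum.elim r fun _ : Unit => r') (Sum.elim c fun _ => x) ρ)
    | .le ρ => .le ρ
    | .dvd g ρ => .dvd (elimDet r c *
        (elimDet (Sum.elim r fun _ : Unit => r') (Sum.elim c fun _ => x) * g)) (elimDet r c •
        elimTerm (Sum.elim r fun _ : Unit => r') (Sum.elim c fun _ => x) ρ) := by
  cases a with
  | le ρ => rfl
  | eq ρ =>
    simp only [elimConstraint, Constraint.vigSub]
    rw [LinTerm.vigSub_eq, smul_elimTerm_sum h0 h1]
  | dvd g ρ =>
    simp only [elimConstraint, Constraint.vigSub]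
    rw [LinTerm.vigSub_eq, smul_elimTerm_sum h0 h1, elimDet_sum h0]
    congr 1; ring

theorem divBy_vigSub_elimConstraint {r : ι → LinTerm (V ⊕ ℕ)} {c : ι → V} (h0 : elimDet r c ≠ 0)
    {r' : LinTerm (V ⊕ ℕ)} {x : V} (h1 : (elimTerm r c r').2 (Sum.inl x) ≠ 0)
    (a : Constraint (V ⊕ ℕ)) :
    ((elimConstraint r c a).vigSub ((elimTerm r c r').2 (Sum.inl x))
      ((elimTerm r c r').erase (Sum.inl x)) (Sum.inl x)).divBy (elimDet r c) =
    elimConstraint (Sum.elim r fun _ : Unit => r') (Sum.elim c fun _ => x) a := by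
  rw [vigSub_elimConstraint h0 h1]
  cases a <;> simp [Constraint.divBy, elimConstraint, LinTerm.divBy_smul h0, exactDiv_mul h0]

/-- This makes the conjoined constraint `f ∣ τ` the image of `1 ∣ -x`. Since `x` is not among the `c
i`, the old elimination only scales `-x` by the old determinant, and the Bareiss step gives that
determinant times `τ`, which is cancelled. -/
theorem elimTerm_neg_varTerm {r : ι → LinTerm (V ⊕ ℕ)} {c : ι → V} (h0 : elimDet r c ≠ 0)
    {r' : LinTerm (V ⊕ ℕ)} {x : V} (h1 : (elimTerm r c r').2 (Sum.inl x) ≠ 0)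
    (hx : ∀ i, c i ≠ x) :
    elimTerm (Sum.elim r fun _ : Unit => r') (Sum.elim c fun _ => x) (-varTerm x) =
      (elimTerm r c r').erase (Sum.inl x) := by
  have e : elimTerm r c (-varTerm x) = elimDet r c • (-varTerm x) :=
    reduce_eq_smul _ _ _ fun j => by simp [colCoeff_apply, varTerm_apply_ne (hx j).symm]
  have := smul_elimTerm_sum h0 h1 (-varTerm x)
  rw [e] at this
  refine smul_right_injective _ h0 ?_
  simp only
  rw [this, LinTerm.erase_eq_sub]
  have hv : (elimDet r c • (-varTerm x : LinTerm (V ⊕ ℕ))).2 (Sum.inl x) = -elimDet r c := by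
    simp [varTerm_apply_inl]
  rw [hv, varTerm]
  module

/-- If the divisibility constraints for the eliminated variables give their values, the elimination
multiplies the value of every term by the determinant. -/
theorem eval_elimTerm {r : ι → LinTerm (V ⊕ ℕ)} {c : ι → V} (h0 : elimDet r c ≠ 0) {t : ℤ}
    {ν : V ⊕ ℕ → ℤ} (h : ∀ i, (elimTerm r c (varTerm (c i))).eval t ν =
      (elimDet r c).eval t * ν (Sum.inl (c i))) (ρ : LinTerm (V ⊕ ℕ)) :
    (elimTerm r c ρ).eval t ν = (elimDet r c).eval t * ρ.eval t ν := by
  -- The `c i` are distinct, as a repeated column would make the determinant zero; hence the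
  -- variables `c i` form a dual family.
  have hc : ∀ i j, colCoeff c j (varTerm (c i)) = if i = j then 1 else 0 := by
    intro i j
    rw [colCoeff_apply]
    split_ifs with hij
    · rw [hij, varTerm_apply_inl]
    · refine varTerm_apply_ne fun hcc => h0 ?_
      exact Matrix.det_zero_of_column_eq hij fun k => by simp [coordMatrix, colCoeff_apply, hcc]
  rw [elimTerm, reduce_eq_sub_sum r (colCoeff c) _ hc ρ, LinTerm.eval_sub, LinTerm.eval_sum,
    Finset.sum_eq_zero, sub_zero, LinTerm.eval_smul]
  · rfl
  · intro j _
    have := h j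
    rw [LinTerm.eval_smul, LinTerm.eval_sub, LinTerm.eval_smul, varTerm_eval]
    rw [elimTerm] at this
    rw [this]
    exact mul_eq_zero_of_right _ (sub_self _)

end Elim

/-! ### Loop states as fraction-free eliminations -/

section Invariant

variable {V : Type*}

/-- The state `S` is obtained from `φ` by processing the variables in `done`: the variables `c i`
are eliminated with the equalities `r i = 0`, and the other ones are bounded. -/
structure Invariant (φ : Formula V) (S : State V) (done : Set V) {ι : Type} [Fintype ι]
    [DecidableEq ι] (r : ι → LinTerm (V ⊕ ℕ)) (c : ι → V) (ψ : Formula (V ⊕ ℕ)) : Prop where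
  det_ne : elimDet r c ≠ 0
  lead_eq : S.lead = elimDet r c
  form_eq : S.φ = ψ.map (elimConstraint r c)
  -- With arbitrary `P`, this says that `ψ` implies the slack form of `φ` and all trivial
  -- constraints `1 ∣ -x`, without fixing the shape of `ψ`; truth after elimination is one such `P`.
  holds : ∀ P : Constraint (V ⊕ ℕ) → Prop, ψ.Holds P →
    (addSlack φ 0).Holds P ∧ ∀ i, P (.dvd 1 (-varTerm (c i)))
  atoms : ∀ a ∈ ψ.atoms, a ∈ (addSlack φ 0).atoms ∨ ∃ i, a = .dvd 1 (-varTerm (c i))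
  rows : ∀ i, Constraint.eq (r i) ∈ (addSlack φ 0).atoms
  -- Equivalently, a slack variable without bound occurs in no row, so elimination only scales its
  -- coefficient.
  bounded : ∀ i k, (r i).2 (Sum.inr k) ≠ 0 → Sum.inr k ∈ S.B.dom
  mem_done : ∀ z, z ∈ done ↔ Sum.inl z ∈ S.B.dom ∨ z ∈ Set.range c
  chi_vars : S.χ.vars = ∅
  chi_pos : ∀ t ν, S.χ.Sat t ν → 0 < S.m.eval t ∧ 0 < S.sign * S.lead.eval t
  sign_eq : S.sign = 1 ∨ S.sign = -1
  lead_dvd : S.lead ∣ S.m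
  dvd_m : ∀ g ρ, Constraint.dvd g ρ ∈ S.φ.atoms → g ∣ S.m

/-- Some elimination data satisfy the invariant. -/
def HasInvariant (φ : Formula V) (S : State V) (done : Set V) : Prop :=
  ∃ (ι : Type) (_ : Fintype ι) (_ : DecidableEq ι) (r : ι → LinTerm (V ⊕ ℕ)) (c : ι → V)
    (ψ : Formula (V ⊕ ℕ)), Invariant φ S done r c ψ

theorem mem_pivots {x : V} {S : State V} {η : LinTerm (V ⊕ ℕ)} :
    η ∈ pivots x S ↔ Constraint.eq η ∈ S.φ.atoms ∧ η.2 (Sum.inl x) ≠ 0 := by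
  simp [pivots, Formula.mem_equalities]

/-- With no rows the determinant is `1` and the elimination is the identity. -/
theorem hasInvariant_initState {φ : Formula V} {Z : List ℤ[X]} {s : ℤ} :
    HasInvariant (zeroDivisors Z φ) (initState φ Z s) ∅ := by
  classical
  have hT : ∀ a : Constraint (V ⊕ ℕ), elimConstraint (Empty.elim : Empty → LinTerm (V ⊕ ℕ))
      (Empty.elim : Empty → V) a = a := by
    intro a
    cases a <;> simp [elimConstraint, elimTerm, reduce, elimDet]
  have hφ : (addSlack (zeroDivisors Z φ) 0).map (elimConstraint
      (Empty.elim : Empty → LinTerm (V ⊕ ℕ)) (Empty.elim : Empty → V)) =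
      addSlack (zeroDivisors Z φ) 0 :=
    (PosBool.map_congr fun a _ => hT a).trans (PosBool.map_id' _)
  refine ⟨Empty, inferInstance, inferInstance, Empty.elim, Empty.elim,
    addSlack (zeroDivisors Z φ) 0, ?_⟩
  constructor
  · simp [elimDet]
  · simp [elimDet, initState]
  · exact hφ.symm
  · exact fun P hP => ⟨hP, fun i => i.elim⟩
  · exact fun a ha => .inl ha
  · exact fun i => i.elim
  · exact fun i => i.elim
  · simp [initState]
  · exact Formula.vars_pos _
  · intro t ν h
    exact ⟨(Formula.sat_pos _ _ _).1 h, by simp [initState]⟩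
  · exact .inl rfl
  · exact one_dvd _
  · intro g ρ h
    have := (dvd_mem_addSlack h).1
    exact Dvd.dvd.mul_left (List.dvd_prod (List.mem_dedup.2 this)) _

theorem Invariant.skip {φ : Formula V} {S : State V} {done : Set V} {ι : Type} [Fintype ι]
    [DecidableEq ι] {r : ι → LinTerm (V ⊕ ℕ)} {c : ι → V} {ψ : Formula (V ⊕ ℕ)}
    (h : Invariant φ S done r c ψ) (x : V) : Invariant φ (skip x S) (insert x done) r c ψ where
  det_ne := h.det_ne
  lead_eq := h.lead_eq
  form_eq := h.form_eq
  holds := h.holds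
  atoms := h.atoms
  rows := h.rows
  bounded i k hk := by
    simp only [PPA.skip, Finset.mem_insert]
    exact .inr (h.bounded i k hk)
  mem_done z := by simp [PPA.skip, h.mem_done z, or_assoc]
  chi_vars := h.chi_vars
  chi_pos := h.chi_pos
  sign_eq := h.sign_eq
  lead_dvd := h.lead_dvd
  dvd_m := h.dvd_m

section

variable {φ : Formula V} {S : State V} {done : Set V} {ι : Type} [Fintype ι]
    [DecidableEq ι] {r : ι → LinTerm (V ⊕ ℕ)} {c : ι → V} {ψ : Formula (V ⊕ ℕ)}

theorem Invariant.exists_atom (h : Invariant φ S done r c ψ) {a : Constraint (V ⊕ ℕ)}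
    (ha : a ∈ S.φ.atoms) : (∃ b ∈ (addSlack φ 0).atoms, a = elimConstraint r c b) ∨
      ∃ i, a = elimConstraint r c (.dvd 1 (-varTerm (c i))) := by
  rw [h.form_eq, PosBool.mem_atoms_map] at ha
  obtain ⟨b, hb, rfl⟩ := ha
  rcases h.atoms b hb with hb | ⟨i, rfl⟩
  · exact .inl ⟨b, hb, rfl⟩
  · exact .inr ⟨i, rfl⟩

theorem Invariant.exists_eq (h : Invariant φ S done r c ψ) {η : LinTerm (V ⊕ ℕ)}
    (hη : Constraint.eq η ∈ S.φ.atoms) :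
    ∃ ρ, Constraint.eq ρ ∈ (addSlack φ 0).atoms ∧ η = elimTerm r c ρ := by
  rcases h.exists_atom hη with ⟨b, hb, e⟩ | ⟨i, e⟩
  · cases b <;> simp only [elimConstraint, Constraint.eq.injEq, reduceCtorEq] at e
    exact ⟨_, hb, e⟩
  · simp [elimConstraint] at e

theorem Invariant.not_le_mem (h : Invariant φ S done r c ψ) (η : LinTerm (V ⊕ ℕ)) :
    Constraint.le η ∉ S.φ.atoms := by
  intro hη
  rcases h.exists_atom hη with ⟨b, hb, e⟩ | ⟨i, e⟩
  · cases b <;> simp [elimConstraint] at e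
    exact not_le_mem_addSlack hb
  · simp [elimConstraint] at e

theorem Invariant.apply_free (h : Invariant φ S done r c ψ) {k : ℕ}
    (hk : Sum.inr k ∉ S.B.dom) (ρ : LinTerm (V ⊕ ℕ)) :
    (elimTerm r c ρ).2 (Sum.inr k) = elimDet r c * ρ.2 (Sum.inr k) :=
  elimTerm_apply _ _ _ _ fun i => by_contra fun hi => hk (h.bounded i k hi)

/-- The coefficient of a free slack variable is zero or the leading coefficient. -/
theorem Invariant.coeff_eq_lead (h : Invariant φ S done r c ψ) {η : LinTerm (V ⊕ ℕ)}
    (hη : Constraint.eq η ∈ S.φ.atoms) {k : ℕ} (hk : Sum.inr k ∉ S.B.dom)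
    (hne : η.2 (Sum.inr k) ≠ 0) : η.2 (Sum.inr k) = S.lead := by
  obtain ⟨ρ, hρ, rfl⟩ := h.exists_eq hη
  rw [h.apply_free hk] at hne ⊢
  obtain ⟨τ, -, -, rfl⟩ := eq_mem_addSlack hρ (right_ne_zero_of_mul hne)
  simp only [lift_add_slackTerm_apply_inr, if_true, mul_one, h.lead_eq]

theorem Invariant.free_unique (h : Invariant φ S done r c ψ) {η : LinTerm (V ⊕ ℕ)}
    (hη : Constraint.eq η ∈ S.φ.atoms) {k j : ℕ} (hk : Sum.inr k ∉ S.B.dom)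
    (hj : Sum.inr j ∉ S.B.dom) (hnk : η.2 (Sum.inr k) ≠ 0) (hnj : η.2 (Sum.inr j) ≠ 0) :
    k = j := by
  obtain ⟨ρ, hρ, rfl⟩ := h.exists_eq hη
  rw [h.apply_free hk] at hnk
  rw [h.apply_free hj] at hnj
  obtain ⟨τ, -, -, rfl⟩ := eq_mem_addSlack hρ (right_ne_zero_of_mul hnk)
  by_contra hkj
  simp [lift_add_slackTerm_apply_inr, hkj, -Prod.snd_add] at hnj

/-- A free slack variable occurs in no row, so it appears only in the reduction of the equality that
introduced it. -/
theorem Invariant.eq_unique (h : Invariant φ S done r c ψ) {η η' : LinTerm (V ⊕ ℕ)}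
    (hη : Constraint.eq η ∈ S.φ.atoms) (hη' : Constraint.eq η' ∈ S.φ.atoms) {k : ℕ}
    (hk : Sum.inr k ∉ S.B.dom) (hn : η.2 (Sum.inr k) ≠ 0) (hn' : η'.2 (Sum.inr k) ≠ 0) :
    η = η' := by
  obtain ⟨ρ, hρ, rfl⟩ := h.exists_eq hη
  obtain ⟨ρ', hρ', rfl⟩ := h.exists_eq hη'
  rw [h.apply_free hk] at hn hn'
  rw [eq_of_mem_addSlack hρ hρ' (right_ne_zero_of_mul hn) (right_ne_zero_of_mul hn')]

theorem Invariant.dvd_free (h : Invariant φ S done r c ψ) {g : ℤ[X]} {η : LinTerm (V ⊕ ℕ)}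
    (hη : Constraint.dvd g η ∈ S.φ.atoms) {k : ℕ} (hk : Sum.inr k ∉ S.B.dom) :
    η.2 (Sum.inr k) = 0 := by
  rcases h.exists_atom hη with ⟨b, hb, e⟩ | ⟨i, e⟩
  · cases b <;> simp only [elimConstraint, Constraint.dvd.injEq, reduceCtorEq] at e
    rw [e.2, h.apply_free hk, (dvd_mem_addSlack hb).2 k, mul_zero]
  · simp only [elimConstraint, Constraint.dvd.injEq] at e
    rw [e.2, h.apply_free hk]
    simp [varTerm_apply_inr]

/-- The variables of the current formula. -/
theorem Invariant.mem_vars (h : Invariant φ S done r c ψ) {z : V} (hz : Sum.inl z ∈ S.φ.vars) :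
    z ∈ φ.vars ∧ z ∉ Set.range c := by
  obtain ⟨a, ha, hne⟩ := hz
  have hc : z ∉ Set.range c := by
    rintro ⟨j, rfl⟩
    cases a with
    | le η => exact h.not_le_mem _ ha
    | eq η =>
      obtain ⟨ρ, -, rfl⟩ := h.exists_eq ha
      exact hne (elimTerm_apply_col _ _ _ _)
    | dvd g η =>
      rcases h.exists_atom ha with ⟨b, hb, e⟩ | ⟨i, e⟩
      · cases b <;> simp only [elimConstraint, Constraint.dvd.injEq, reduceCtorEq] at e
        rw [e.2] at hne
        exact hne (elimTerm_apply_col _ _ _ _)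
      · simp only [elimConstraint, Constraint.dvd.injEq] at e
        rw [e.2] at hne
        exact hne (elimTerm_apply_col _ _ _ _)
  refine ⟨?_, hc⟩
  -- A variable foreign to `φ` occurs in no row, so elimination only scales its zero coefficient.
  by_contra hzφ
  have hr : ∀ i, (r i).2 (Sum.inl z) = 0 := fun i =>
    by_contra fun hi => hzφ (vars_addSlack (h.rows i) hi)
  have hb0 : ∀ b ∈ (addSlack φ 0).atoms, b.term.2 (Sum.inl z) = 0 := fun b hb =>
    by_contra fun hi => hzφ (vars_addSlack hb hi)
  apply hne
  rcases h.exists_atom ha with ⟨b, hb, rfl⟩ | ⟨i, rfl⟩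
  · have := hb0 b hb
    cases b with
    | le η => exact this
    | eq η =>
      simp only [elimConstraint, Constraint.term] at this ⊢
      rw [elimTerm_apply _ _ _ _ hr, this, mul_zero]
    | dvd g η =>
      simp only [elimConstraint, Constraint.term] at this ⊢
      rw [elimTerm_apply _ _ _ _ hr, this, mul_zero]
  · simp only [elimConstraint, Constraint.term]
    rw [elimTerm_apply _ _ _ _ hr]
    simp [varTerm_apply_ne (fun e => hc ⟨i, e⟩)]

theorem Invariant.divisible (h : Invariant φ S done r c ψ) {x : V} {η : LinTerm (V ⊕ ℕ)}
    (hη : η ∈ pivots x S) : ∀ a ∈ (S.φ.map (Constraint.vigSub (η.2 (Sum.inl x))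
      (LinTerm.erase (Sum.inl x) η) (Sum.inl x))).atoms, a.DivisibleBy S.lead := by
  intro a ha
  rw [mem_pivots] at hη
  obtain ⟨hη, hx⟩ := hη
  obtain ⟨ρ, hρ, rfl⟩ := h.exists_eq hη
  rw [PosBool.mem_atoms_map] at ha
  obtain ⟨b, hb, rfl⟩ := ha
  have hb' := hb
  rw [h.form_eq, PosBool.mem_atoms_map] at hb
  obtain ⟨d, hd, rfl⟩ := hb
  rw [vigSub_elimConstraint h.det_ne hx, h.lead_eq]
  cases d with
  | le τ => exact absurd hb' (h.not_le_mem _)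
  | eq τ => exact LinTerm.divisibleBy_smul _ _
  | dvd g τ => exact ⟨dvd_mul_right _ _, LinTerm.divisibleBy_smul _ _⟩

/-- The pivot is the reduction of an initial equality `ρ = 0`. That equality becomes the new row,
and `ψ` gains the trivial conjunct `1 ∣ -x`. -/
theorem Invariant.eliminate (h : Invariant φ S done r c ψ) {x : V} (hx : x ∉ done)
    {ρ : LinTerm (V ⊕ ℕ)} (hρ : Constraint.eq ρ ∈ (addSlack φ 0).atoms)
    (hne : (elimTerm r c ρ).2 (Sum.inl x) ≠ 0) {s : ℤ} (hs : s = 1 ∨ s = -1) :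
    Invariant φ (eliminate x (elimTerm r c ρ) s S) (insert x done)
      (Sum.elim r fun _ : Unit => ρ) (Sum.elim c fun _ => x)
      (ψ.and (.atom (.dvd 1 (-varTerm x)))) := by
  have hxc : ∀ i, c i ≠ x := fun i hi => hx ((h.mem_done x).2 (.inr ⟨i, hi⟩))
  have hdet := elimDet_sum h.det_ne ρ x
  have hform : (PPA.eliminate x (elimTerm r c ρ) s S).φ =
      (ψ.and (.atom (.dvd 1 (-varTerm x)))).map
        (elimConstraint (Sum.elim r fun _ : Unit => ρ) (Sum.elim c fun _ => x)) := by
    simp only [PPA.eliminate, PosBool.map, elimConstraint]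
    rw [hdet, mul_one, elimTerm_neg_varTerm h.det_ne hne hxc, h.form_eq, h.lead_eq,
      PosBool.map_map, PosBool.map_map]
    congr 1
    exact PosBool.map_congr fun a _ => divBy_vigSub_elimConstraint h.det_ne hne a
  constructor
  · rw [hdet]; exact hne
  · exact hdet.symm
  · exact hform
  · rintro P ⟨h1, h2⟩
    refine ⟨(h.holds P h1).1, ?_⟩
    rintro (i | i)
    · exact (h.holds P h1).2 i
    · exact h2
  · intro a ha
    simp only [PosBool.atoms, List.mem_append, List.mem_singleton] at ha
    rcases ha with ha | rfl
    · exact (h.atoms a ha).imp id fun ⟨i, hi⟩ => ⟨.inl i, hi⟩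
    · exact .inr ⟨.inr (), rfl⟩
  · rintro (i | i)
    · exact h.rows i
    · exact hρ
  · intro i k hk
    simp only [PPA.eliminate, Finset.mem_union, Finset.mem_filter, Finsupp.mem_support_iff]
    by_cases hd : Sum.inr k ∈ S.B.dom
    · exact .inl hd
    rcases i with i | i
    · exact .inl (h.bounded i k hk)
    · refine .inr ⟨?_, rfl, hd⟩
      rw [LinTerm.erase_apply_ne (by simp), h.apply_free hd]
      exact mul_ne_zero h.det_ne hk
  · intro z
    simp only [PPA.eliminate, Set.mem_insert_iff, h.mem_done z, Finset.mem_union,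
      Finset.mem_filter, FreeSlack, Sum.isRight_inl, Bool.false_eq_true, false_and, and_false,
      or_false, Set.mem_range, Sum.exists, Sum.elim_inl, Sum.elim_inr, exists_const]
    tauto
  · simp only [PPA.eliminate]
    rw [Formula.vars_and, h.chi_vars, Formula.vars_pos, Set.union_empty]
  · rintro t ν ⟨h1, h2⟩
    have h3 := (h.chi_pos t ν h1).1
    have h4 := (Formula.sat_pos t ν _).1 h2
    simp only [PPA.eliminate, Polynomial.eval_mul, Polynomial.eval_C] at h4 ⊢
    exact ⟨mul_pos h4 h3, h4⟩
  · exact hs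
  · exact Dvd.dvd.mul_right (dvd_mul_left _ _) _
  · intro g τ hg
    rw [hform, PosBool.mem_atoms_map] at hg
    obtain ⟨a, ha, e⟩ := hg
    simp only [PosBool.atoms, List.mem_append, List.mem_singleton] at ha
    simp only [PPA.eliminate]
    rcases ha with ha | rfl
    · cases a <;> simp only [elimConstraint, Constraint.dvd.injEq, reduceCtorEq] at e
      rename_i g' τ'
      -- The factor `g'` divides the old divisor and thus the old `m`; the new `m` has the extra
      -- factor that the new divisor needs.
      have := h.dvd_m (elimDet r c * g') (elimTerm r c τ')
        (by rw [h.form_eq, PosBool.mem_atoms_map]; exact ⟨_, ha, rfl⟩)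
      rw [← e.1, hdet, mul_assoc]
      exact Dvd.dvd.mul_left (mul_dvd_mul_left _ (dvd_trans (dvd_mul_left _ _) this)) _
    · simp only [elimConstraint, Constraint.dvd.injEq] at e
      rw [← e.1, hdet, mul_one]
      exact Dvd.dvd.mul_right (dvd_mul_left _ _) _

end

theorem HasInvariant.iteration {φ : Formula V} {S : State V} {done : Set V}
    (h : HasInvariant φ S done) {x : V} (hx : x ∉ done) {S' : State V}
    (hS : S' ∈ iteration x S) : HasInvariant φ S' (insert x done) := by
  obtain ⟨ι, _, _, r, c, ψ, h⟩ := h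
  simp only [PPA.iteration, List.mem_cons, List.mem_flatMap, List.map_cons, List.map_nil,
    List.not_mem_nil, or_false] at hS
  rcases hS with rfl | ⟨η, hη, hS⟩
  · exact ⟨ι, _, _, r, c, ψ, h.skip x⟩
  · rw [mem_pivots] at hη
    obtain ⟨hη, hne⟩ := hη
    obtain ⟨ρ, hρ, rfl⟩ := h.exists_eq hη
    rcases hS with rfl | rfl
    · exact ⟨_, _, _, _, _, _, h.eliminate hx hρ hne (.inl rfl)⟩
    · exact ⟨_, _, _, _, _, _, h.eliminate hx hρ hne (.inr rfl)⟩

theorem HasInvariant.loop {φ : Formula V} {xs : List V} {S : State V} {done : Set V}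
    (h : HasInvariant φ S done) (hxs : xs.Nodup) (hd : ∀ x ∈ xs, x ∉ done) {S' : State V}
    (hS : S' ∈ loop xs S) : HasInvariant φ S' (done ∪ {x | x ∈ xs}) := by
  induction xs generalizing S done with
  | nil =>
    obtain rfl : S' = S := by simpa [PPA.loop] using hS
    simpa using h
  | cons x xs ih =>
    simp only [PPA.loop, List.mem_flatMap] at hS
    obtain ⟨S1, hS1, hS⟩ := hS
    rw [List.nodup_cons] at hxs
    have := ih (h.iteration (hd x (by simp)) hS1) hxs.2 (fun z hz => by
      rintro (rfl | hz')
      · exact hxs.1 hz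
      · exact hd z (by simp [hz]) hz') hS
    convert this using 1
    ext z
    simp only [Set.mem_union, Set.mem_ofPred_eq, List.mem_cons, Set.mem_insert_iff]
    tauto

end Invariant

/-! ### The output of a branch -/

section Finish

variable {V : Type*}

open Classical in
/-- The term without the free slack variables. -/
noncomputable def withoutFreeSlack (B : BoundMap (V ⊕ ℕ)) (η : LinTerm (V ⊕ ℕ)) :
    LinTerm (V ⊕ ℕ) := (η.1, η.2.filter fun v => ¬ FreeSlack B v)

theorem freeSlack_inr {B : BoundMap (V ⊕ ℕ)} {k : ℕ} :
    FreeSlack B (Sum.inr k) ↔ Sum.inr k ∉ B.dom := by simp [FreeSlack]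

theorem FreeSlack.exists_eq {B : BoundMap (V ⊕ ℕ)} {v : V ⊕ ℕ} (h : FreeSlack B v) :
    ∃ k, v = Sum.inr k ∧ Sum.inr k ∉ B.dom := by
  rcases v with v | k
  · simp [FreeSlack] at h
  · exact ⟨k, rfl, h.2⟩

theorem dropSlack_eq_free {B : BoundMap (V ⊕ ℕ)} {s : ℤ} {η : LinTerm (V ⊕ ℕ)}
    (h : ∃ y, FreeSlack B y ∧ η.2 y ≠ 0) : (Constraint.eq η).dropSlack B s =
      if s = 1 then .le (withoutFreeSlack B η) else .le (-withoutFreeSlack B η) := by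
  simp only [Constraint.dropSlack, if_pos h]
  rfl

theorem dropSlack_eq_bound {B : BoundMap (V ⊕ ℕ)} {s : ℤ} {η : LinTerm (V ⊕ ℕ)}
    (h : ¬∃ y, FreeSlack B y ∧ η.2 y ≠ 0) : (Constraint.eq η).dropSlack B s = .eq η := by
  simp only [Constraint.dropSlack, if_neg h]

theorem withoutFreeSlack_add {B : BoundMap (V ⊕ ℕ)} {η : LinTerm (V ⊕ ℕ)} {k : ℕ}
    (hk : Sum.inr k ∉ B.dom) (h : ∀ j, Sum.inr j ∉ B.dom → j ≠ k → η.2 (Sum.inr j) = 0) :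
    withoutFreeSlack B η + η.2 (Sum.inr k) • slackTerm V k = η := by
  classical
  refine Prod.ext (by simp [withoutFreeSlack, slackTerm]) ?_
  ext1 v
  have e : (withoutFreeSlack B η + η.2 (Sum.inr k) • slackTerm V k).2 v =
      (if ¬ FreeSlack B v then η.2 v else 0) + η.2 (Sum.inr k) * (slackTerm V k).2 v := by
    simp [withoutFreeSlack, Finsupp.filter_apply]
  rw [e]
  rcases v with v | j
  · simp [FreeSlack, slackTerm_apply_inl]
  · rw [slackTerm_apply_inr, freeSlack_inr]
    by_cases hj : Sum.inr j ∈ B.dom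
    · have : k ≠ j := fun e => hk (e ▸ hj)
      simp [hj, this]
    · by_cases hkj : k = j
      · subst hkj; simp [hj]
      · simp [hj, hkj, h j hj (Ne.symm hkj)]

theorem eval_withoutFreeSlack (t : ℤ) (ν : V ⊕ ℕ → ℤ) {B : BoundMap (V ⊕ ℕ)}
    {η : LinTerm (V ⊕ ℕ)} {k : ℕ} (hk : Sum.inr k ∉ B.dom)
    (h : ∀ j, Sum.inr j ∉ B.dom → j ≠ k → η.2 (Sum.inr j) = 0) :
    (withoutFreeSlack B η).eval t ν =
      η.eval t ν - (η.2 (Sum.inr k)).eval t * ν (Sum.inr k) := by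
  conv_rhs => rw [← withoutFreeSlack_add hk h]
  rw [LinTerm.eval_add, LinTerm.eval_smul, slackTerm_eval, withoutFreeSlack_add hk h,
    add_sub_cancel_right]

variable {φ : Formula V} {S : State V} {done : Set V} {ι : Type} [Fintype ι]
    [DecidableEq ι] {r : ι → LinTerm (V ⊕ ℕ)} {c : ι → V} {ψ : Formula (V ⊕ ℕ)}

theorem Invariant.not_free_dropSlack (h : Invariant φ S done r c ψ) {a : Constraint (V ⊕ ℕ)}
    (ha : a ∈ S.φ.atoms) {v : V ⊕ ℕ} (hv : (a.dropSlack S.B S.sign).term.2 v ≠ 0) :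
    ¬ FreeSlack S.B v ∧ a.term.2 v ≠ 0 := by
  classical
  cases a with
  | le η => exact absurd ha (h.not_le_mem _)
  | dvd g η =>
    refine ⟨fun hf => hv ?_, hv⟩
    obtain ⟨k, rfl, hk⟩ := hf.exists_eq
    exact h.dvd_free ha hk
  | eq η =>
    by_cases he : ∃ y, FreeSlack S.B y ∧ η.2 y ≠ 0
    · have : (withoutFreeSlack S.B η).2 v ≠ 0 := by
        rw [dropSlack_eq_free he] at hv
        split_ifs at hv
        · exact hv
        · simpa [Constraint.term] using hv
      simp only [withoutFreeSlack, Finsupp.filter_apply] at this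
      by_cases hf : FreeSlack S.B v
      · simp [hf] at this
      · exact ⟨hf, by simpa [hf, Constraint.term] using this⟩
    · rw [dropSlack_eq_bound he] at hv
      exact ⟨fun hf => he ⟨v, hf, hv⟩, hv⟩

theorem Invariant.vars_finish (h : Invariant φ S done r c ψ) {v : V ⊕ ℕ}
    (hv : v ∈ Formula.vars (finish S).body) :
    v ∈ S.B.dom ∨ ∃ z ∈ φ.vars, z ∉ done ∧ v = Sum.inl z := by
  rw [finish, Formula.vars_and, h.chi_vars, Set.union_empty] at hv
  obtain ⟨b, hb, hv⟩ := hv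
  rw [PosBool.mem_atoms_map] at hb
  obtain ⟨a, ha, rfl⟩ := hb
  obtain ⟨hf, hv⟩ := h.not_free_dropSlack ha hv
  rcases v with z | k
  · obtain ⟨h1, h2⟩ := h.mem_vars ⟨a, ha, hv⟩
    by_cases hz : Sum.inl z ∈ S.B.dom
    · exact .inl hz
    · exact .inr ⟨z, h1, fun hd => ((h.mem_done z).1 hd).elim hz h2, rfl⟩
  · rw [freeSlack_inr, not_not] at hf
    exact .inl hf

/-- Soundness of a branch. -/
theorem Invariant.exists_sat_of_finish (h : Invariant φ S done r c ψ) {t : ℤ} {ν : V ⊕ ℕ → ℤ}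
    (hs : (finish S).Sat t ν) :
    ∃ μ : V → ℤ, (∀ z, z ∉ done → μ z = ν (Sum.inl z)) ∧ φ.Sat t μ := by
  classical
  obtain ⟨ν', hν, hB, hφ, hχ⟩ := hs
  have hp := (h.chi_pos t ν' hχ).2
  rw [h.lead_eq] at hp
  have hp0 : (elimDet r c).eval t ≠ 0 := right_ne_zero_of_mul hp.ne'
  rw [PosBool.holds_map, h.form_eq, PosBool.holds_map] at hφ
  obtain ⟨h1, h2⟩ := h.holds _ hφ
  -- The reduced constraints `1 ∣ -x` yield the integer values of the eliminated variables.
  have hq : ∀ z, ∃ q : ℤ, z ∈ Set.range c →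
      (elimTerm r c (varTerm z)).eval t ν' = (elimDet r c).eval t * q := by
    intro z
    by_cases hz : z ∈ Set.range c
    · obtain ⟨i, rfl⟩ := hz
      have := h2 i
      simp only [Function.comp, elimConstraint, Constraint.dropSlack, Constraint.Holds, mul_one,
        elimTerm, reduce_neg, LinTerm.eval_neg, dvd_neg] at this
      obtain ⟨q, hq⟩ := this
      exact ⟨q, fun _ => hq⟩
    · exact ⟨0, fun h => absurd h hz⟩
  choose q hq using hq
  let ν1 : V ⊕ ℕ → ℤ := Sum.elim (fun z => if z ∈ Set.range c then q z else ν' (Sum.inl z))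
    fun k => ν' (Sum.inr k)
  -- Reduced terms do not contain the eliminated variables, whose values may therefore be
  -- reassigned.
  have hcongr : ∀ ρ, (elimTerm r c ρ).eval t ν1 = (elimTerm r c ρ).eval t ν' := by
    intro ρ
    refine LinTerm.eval_congr t _ fun v hv => ?_
    rcases v with z | k
    · have : z ∉ Set.range c := by
        rintro ⟨j, rfl⟩
        exact hv (elimTerm_apply_col _ _ _ _)
      simp only [ν1, Sum.elim_inl, this, if_false]
    · rfl
  have hev : ∀ ρ, (elimTerm r c ρ).eval t ν' = (elimDet r c).eval t * ρ.eval t ν1 := by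
    intro ρ
    rw [← hcongr]
    refine eval_elimTerm h.det_ne (fun i => ?_) ρ
    rw [hcongr, hq _ ⟨i, rfl⟩]
    simp [ν1]
  refine ⟨fun z => ν1 (Sum.inl z), fun z hz => ?_, holds_of_addSlack (fun τ hτ => ?_)
    (fun τ j hτ => ?_) (fun f τ hτ => ?_) h1⟩
  · have hz' : z ∉ Set.range c := fun hc => hz ((h.mem_done z).2 (.inr hc))
    have hd : Sum.inl z ∉ S.B.dom := fun hc => hz ((h.mem_done z).2 (.inl hc))
    simp only [ν1, Sum.elim_inl, hz', if_false]
    exact hν _ hd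
  · have hn : ¬∃ y, FreeSlack S.B y ∧ (elimTerm r c τ.lift).2 y ≠ 0 := by
      rintro ⟨y, hy, hne⟩
      obtain ⟨k, rfl, hk⟩ := hy.exists_eq
      rw [h.apply_free hk, LinTerm.lift_apply_inr, mul_zero] at hne
      exact hne rfl
    simp only [Function.comp, elimConstraint, dropSlack_eq_bound hn, Constraint.Holds, hev,
      LinTerm.eval_lift] at hτ ⊢
    exact (mul_eq_zero.1 hτ).resolve_left hp0
  · simp only [Function.comp, elimConstraint] at hτ
    have hcoef : ∀ k, Sum.inr k ∉ S.B.dom →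
        (elimTerm r c (τ.lift + slackTerm V j)).2 (Sum.inr k) =
          elimDet r c * if j = k then 1 else 0 := by
      intro k hk
      rw [h.apply_free hk, lift_add_slackTerm_apply_inr]
    have hev' := hev (τ.lift + slackTerm V j)
    rw [LinTerm.eval_add, LinTerm.eval_lift, slackTerm_eval] at hev'
    change LinTerm.eval t (fun z => ν1 (Sum.inl z)) τ ≤ 0
    change _ = _ * (_ + ν' (Sum.inr j)) at hev'
    -- A bounded slack variable is nonnegative by its bound. A free one was dropped, and what
    -- remains is the determinant times the original term.
    by_cases hj : Sum.inr j ∈ S.B.dom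
    · have hn : ¬∃ y, FreeSlack S.B y ∧ (elimTerm r c (τ.lift + slackTerm V j)).2 y ≠ 0 := by
        rintro ⟨y, hy, hne⟩
        obtain ⟨k, rfl, hk⟩ := hy.exists_eq
        have : j ≠ k := fun e => hk (e ▸ hj)
        rw [hcoef k hk, if_neg this, mul_zero] at hne
        exact hne rfl
      rw [dropSlack_eq_bound hn] at hτ
      simp only [Constraint.Holds] at hτ
      rw [hev'] at hτ
      have := (mul_eq_zero.1 hτ).resolve_left hp0
      have := (hB _ hj).1
      omega
    · have hf : ∃ y, FreeSlack S.B y ∧ (elimTerm r c (τ.lift + slackTerm V j)).2 y ≠ 0 := by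
        refine ⟨_, freeSlack_inr.2 hj, ?_⟩
        rw [hcoef j hj]
        simpa using h.det_ne
      rw [dropSlack_eq_free hf] at hτ
      have he := eval_withoutFreeSlack t ν' (η := elimTerm r c (τ.lift + slackTerm V j)) hj
        (fun k hk hkj => by rw [hcoef k hk, if_neg (Ne.symm hkj), mul_zero])
      rw [hcoef j hj, if_pos rfl, mul_one, hev', mul_add, add_sub_cancel_right] at he
      by_contra hc
      push Not at hc
      rcases h.sign_eq with hs | hs
      · rw [if_pos hs] at hτ
        simp only [Constraint.Holds] at hτ
        rw [hs, one_mul] at hp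
        rw [he] at hτ
        exact absurd hτ (not_le.2 (mul_pos hp hc))
      · rw [hs] at hτ hp
        rw [if_neg (by decide)] at hτ
        simp only [Constraint.Holds, LinTerm.eval_neg] at hτ
        rw [he, ← neg_mul] at hτ
        exact absurd hτ (not_le.2 (mul_pos (by linarith) hc))
  · simp only [Function.comp, elimConstraint, Constraint.dropSlack, Constraint.Holds, hev,
      LinTerm.eval_lift, Polynomial.eval_mul] at hτ ⊢
    exact (mul_dvd_mul_iff_left hp0).1 hτ

/-! ### Completeness -/

/-- The valuation `μ` satisfies the formula of the state `S`, with its bounds, and agrees with `ν`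
outside of `xs` and the slack variables. -/
structure Solves (t : ℤ) (ν : V ⊕ ℕ → ℤ) (xs : List V) (S : State V) (μ : V ⊕ ℕ → ℤ) : Prop where
  agree : ∀ z, z ∉ xs → μ (Sum.inl z) = ν (Sum.inl z)
  bounds : ∀ w ∈ S.B.dom, 0 ≤ μ w ∧ μ w ≤ (S.B.bound w).eval t
  nonneg : ∀ v, FreeSlack S.B v → 0 ≤ μ v
  sat : S.φ.Sat t μ
  sat_chi : S.χ.Sat t μ

variable {t : ℤ} {ν μ : V ⊕ ℕ → ℤ} {xs : List V}

theorem Invariant.finish_sat (h : Invariant φ S {x | x ∈ xs} r c ψ) (hs : Solves t ν xs S μ) :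
    (finish S).Sat t ν := by
  classical
  have hbody : (finish S).body.Sat t μ := by
    refine ⟨?_, hs.sat_chi⟩
    rw [PosBool.holds_map]
    refine PosBool.holds_mono (fun a ha hH => ?_) hs.sat
    cases a with
    | le η => exact hH
    | dvd g η => exact hH
    | eq η =>
      simp only [Function.comp]
      by_cases hf : ∃ y, FreeSlack S.B y ∧ η.2 y ≠ 0
      · rw [dropSlack_eq_free hf]
        obtain ⟨y, hy, hne⟩ := hf
        have hn := hs.nonneg y hy
        obtain ⟨k, rfl, hk⟩ := hy.exists_eq
        have he := eval_withoutFreeSlack t μ (η := η) hk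
          (fun j hj hjk => by_contra fun hc => hjk (h.free_unique ha hj hk hc hne))
        have hH' : η.eval t μ = 0 := hH
        rw [h.coeff_eq_lead ha hk hne, hH', zero_sub] at he
        -- Without its free slack variable `y`, the true equality evaluates to `-lead(t) * y` with
        -- `y ≥ 0`; the sign of `lead(t)` gives the inequality.
        have hp := (h.chi_pos t μ hs.sat_chi).2
        rcases h.sign_eq with hsg | hsg
        · rw [if_pos hsg]
          rw [hsg, one_mul] at hp
          simp only [Constraint.Holds]
          rw [he]
          exact neg_nonpos.2 (mul_nonneg hp.le hn)
        · rw [hsg, if_neg (by decide)]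
          rw [hsg] at hp
          simp only [Constraint.Holds, LinTerm.eval_neg]
          rw [he, neg_neg]
          exact mul_nonpos_of_nonpos_of_nonneg (by linarith) hn
      · rw [dropSlack_eq_bound hf]
        exact hH
  -- Outside the bounded variables, the output contains only variables on which `μ` and `ν` agree.
  refine ⟨fun v => if v ∈ S.B.dom then μ v else ν v, fun v hv => if_neg hv, fun w hw => ?_,
    Formula.sat_congr t (fun v hv => ?_) hbody⟩
  · simp only [show w ∈ S.B.dom from hw]
    exact hs.bounds w hw
  · by_cases hd : v ∈ S.B.dom
    · rw [if_pos hd]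
    · rw [if_neg hd]
      obtain ⟨z, -, hz, rfl⟩ := (h.vars_finish hv).resolve_left hd
      exact hs.agree z hz

/-- The valuation stays the same. Bounds have to be supplied only for the slack variables of the
pivot that were free. -/
theorem Invariant.eliminate_solves (h : Invariant φ S done r c ψ) (hs : Solves t ν xs S μ)
    {x : V} {η : LinTerm (V ⊕ ℕ)} (hη : Constraint.eq η ∈ S.φ.atoms) (hη0 : η.eval t μ = 0)
    {s : ℤ} (hpos : 0 < s * (η.2 (Sum.inl x)).eval t)
    (hb : ∀ v, FreeSlack S.B v → η.2 v ≠ 0 →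
      μ v ≤ s * (η.2 (Sum.inl x)).eval t * S.m.eval t - 1) :
    Solves t ν xs (PPA.eliminate x η s S) μ where
  agree := hs.agree
  bounds w hw := by
    classical
    simp only [PPA.eliminate, Finset.mem_union, Finset.mem_filter, Finsupp.mem_support_iff] at hw ⊢
    by_cases hf : FreeSlack S.B w
    · have hw' := hw.resolve_left hf.2
      rw [if_pos hw']
      obtain ⟨k, rfl, hk⟩ := hf.exists_eq
      refine ⟨hs.nonneg _ hf, ?_⟩
      simp only [Polynomial.eval_sub, Polynomial.eval_mul, Polynomial.eval_C, Polynomial.eval_one]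
      refine hb _ hf ?_
      have := hw'.1
      rwa [LinTerm.erase_apply_ne (by simp)] at this
    · rw [if_neg fun hc => hf hc.2]
      exact hs.bounds w (hw.resolve_right fun hc => hf hc.2)
  nonneg v hv := hs.nonneg v ⟨hv.1, fun hd => hv.2 (by
    simp only [PPA.eliminate, Finset.mem_union]; exact .inl hd)⟩
  sat := by
    have hne : (η.2 (Sum.inl x)).eval t ≠ 0 := right_ne_zero_of_mul hpos.ne'
    have hp0 : (elimDet r c).eval t ≠ 0 := by
      rw [← h.lead_eq]
      exact right_ne_zero_of_mul (h.chi_pos t μ hs.sat_chi).2.ne'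
    obtain ⟨ρ, hρ, rfl⟩ := h.exists_eq hη
    have hne' : (elimTerm r c ρ).2 (Sum.inl x) ≠ 0 := by
      intro e; simp [e] at hne
    -- The Bareiss identity, evaluated where the pivot equality is true: its second summand
    -- vanishes.
    have hstep : ∀ σ, (elimDet r c).eval t * (elimTerm (Sum.elim r fun _ : Unit => ρ)
        (Sum.elim c fun _ => x) σ).eval t μ =
        ((elimTerm r c ρ).2 (Sum.inl x)).eval t * (elimTerm r c σ).eval t μ := by
      intro σ
      rw [← LinTerm.eval_smul, smul_elimTerm_sum h.det_ne hne', LinTerm.eval_sub,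
        LinTerm.eval_smul, LinTerm.eval_smul, hη0, mul_zero, sub_zero]
    refine ⟨?_, ?_⟩
    · rw [PosBool.holds_map, PosBool.holds_map]
      refine PosBool.holds_mono (fun a ha hH => ?_) hs.sat
      have ha' := ha
      rw [h.form_eq, PosBool.mem_atoms_map] at ha'
      obtain ⟨b, hb, rfl⟩ := ha'
      simp only [Function.comp]
      rw [h.lead_eq, divBy_vigSub_elimConstraint h.det_ne hne']
      cases b with
      | le σ => exact absurd ha (h.not_le_mem _)
      | eq σ =>
        simp only [elimConstraint, Constraint.Holds] at hH ⊢
        have := hstep σ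
        rw [hH, mul_zero] at this
        exact (mul_eq_zero.1 this).resolve_left hp0
      | dvd g σ =>
        simp only [elimConstraint, Constraint.Holds, Polynomial.eval_mul] at hH ⊢
        rw [elimDet_sum h.det_ne]
        refine (mul_dvd_mul_iff_left hp0).1 ?_
        rw [hstep, mul_left_comm]
        exact mul_dvd_mul_left _ hH
    · simp only [PosBool.Holds, Constraint.Holds]
      rw [LinTerm.erase_eq_sub, LinTerm.eval_sub, hη0, LinTerm.eval_smul, zero_sub, dvd_neg]
      exact dvd_mul_right _ _
  sat_chi := ⟨hs.sat_chi, (Formula.sat_pos _ _ _).2 (by simpa using hpos)⟩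

end Finish

/-- Take the first step `n` at which some coordinate becomes negative. At `n - 1` all are still
nonnegative, and that coordinate is less than the length of one step. -/
theorem exists_shift_neg {A : Type*} {P : A → Prop} {a d : A → ℤ} (ha : ∀ v, P v → 0 ≤ a v)
    {v₀ : A} (h0 : P v₀) (hd : d v₀ < 0) :
    ∃ δ : ℤ, (∀ v, P v → 0 ≤ a v + δ * d v) ∧ ∃ v, P v ∧ d v ≠ 0 ∧ a v + δ * d v < |d v| := by
  classical
  have hex : ∃ n : ℕ, ∃ v, P v ∧ a v + n * d v < 0 := by
    refine ⟨(a v₀ + 1).toNat, v₀, h0, ?_⟩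
    rw [Int.toNat_of_nonneg (by have := ha v₀ h0; omega)]
    nlinarith [ha v₀ h0]
  obtain ⟨v, hv, hlt⟩ := Nat.find_spec hex
  obtain ⟨k, hk⟩ : ∃ k, Nat.find hex = k + 1 := by
    refine Nat.exists_eq_succ_of_ne_zero fun h => ?_
    rw [h] at hlt
    have := ha v hv
    push_cast at hlt
    omega
  have hmin := Nat.find_min hex (m := k) (by omega)
  push Not at hmin
  rw [hk] at hlt
  push_cast at hlt
  have h1 := hmin v hv
  have h2 : d v < 0 := by nlinarith
  exact ⟨k, hmin, v, hv, h2.ne, by rw [abs_of_neg h2]; linarith⟩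

/-- Move along a line until a coordinate is less than its slope. -/
theorem exists_shift {A : Type*} {P : A → Prop} {a d : A → ℤ} (ha : ∀ v, P v → 0 ≤ a v)
    {v₀ : A} (h0 : P v₀) (hd : d v₀ ≠ 0) :
    ∃ δ : ℤ, (∀ v, P v → 0 ≤ a v + δ * d v) ∧ ∃ v, P v ∧ d v ≠ 0 ∧ a v + δ * d v < |d v| := by
  rcases lt_or_gt_of_ne hd with hd | hd
  · exact exists_shift_neg ha h0 hd
  · obtain ⟨δ, h1, v, h2, h3, h4⟩ := exists_shift_neg (d := fun v => -d v) ha h0 (by simpa using hd)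
    refine ⟨-δ, fun v hv => ?_, v, h2, by simpa using h3, ?_⟩
    · have := h1 v hv; linarith
    · rw [abs_neg] at h4; linarith

theorem exists_sign {a : ℤ} (h : a ≠ 0) : ∃ s : ℤ, (s = 1 ∨ s = -1) ∧ s * a = |a| := by
  rcases lt_or_gt_of_ne h with h | h
  · exact ⟨-1, .inr rfl, by rw [abs_of_neg h]; ring⟩
  · exact ⟨1, .inl rfl, by rw [abs_of_pos h]; ring⟩

/-! ### Following a solution through the guesses -/

section Complete

variable {V : Type*} {φ : Formula V} {S : State V} {done : Set V} {ι : Type} [Fintype ι]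
    [DecidableEq ι] {r : ι → LinTerm (V ⊕ ℕ)} {c : ι → V} {ψ : Formula (V ⊕ ℕ)}
    {t : ℤ} {ν μ : V ⊕ ℕ → ℤ} {xs : List V}

theorem eliminate_mem_iteration {x : V} {η : LinTerm (V ⊕ ℕ)}
    (hη : Constraint.eq η ∈ S.φ.atoms) (hne : η.2 (Sum.inl x) ≠ 0) {s : ℤ}
    (hs : s = 1 ∨ s = -1) : eliminate x η s S ∈ iteration x S := by
  simp only [iteration, List.mem_cons, List.mem_flatMap]
  refine .inr ⟨η, mem_pivots.2 ⟨hη, hne⟩, ?_⟩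
  rcases hs with rfl | rfl <;> simp

/-- If all true equalities with `x` have a free slack variable, then `x` can be moved by multiples
of `m(t)`, together with the free slack variables. -/
theorem Invariant.exists_direction (h : Invariant φ S done r c ψ) {x : V} (μ : V ⊕ ℕ → ℤ)
    (hA : ∀ η, Constraint.eq η ∈ S.φ.atoms → η.eval t μ = 0 →
      (∀ v, FreeSlack S.B v → η.2 v = 0) → (η.2 (Sum.inl x)).eval t = 0)
    {q : ℤ[X]} (hq : S.m = S.lead * q) :
    ∃ d : V ⊕ ℕ → ℤ, d (Sum.inl x) = S.m.eval t ∧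
      (∀ v, v ≠ Sum.inl x → ¬ FreeSlack S.B v → d v = 0) ∧
      (∀ v, FreeSlack S.B v → d v ≠ 0 → ∃ η, Constraint.eq η ∈ S.φ.atoms ∧ η.eval t μ = 0 ∧
        η.2 v ≠ 0 ∧ d v = -((η.2 (Sum.inl x)).eval t * q.eval t)) ∧
      ∀ δ : ℤ, ∀ a ∈ S.φ.atoms, a.Holds t μ → a.Holds t fun v => μ v + δ * d v := by
  classical
  -- A free slack variable moves only if its equality, unique by `eq_unique`, is true; false
  -- equalities need not be preserved.
  let T : V ⊕ ℕ → LinTerm (V ⊕ ℕ) → Prop := fun v η =>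
    Constraint.eq η ∈ S.φ.atoms ∧ η.eval t μ = 0 ∧ η.2 v ≠ 0
  have hd : ∀ v, ∃ e : ℤ, (v = Sum.inl x → e = S.m.eval t) ∧
      (v ≠ Sum.inl x → ¬ FreeSlack S.B v → e = 0) ∧
      (FreeSlack S.B v → ∀ η, T v η → e = -((η.2 (Sum.inl x)).eval t * q.eval t)) ∧
      (FreeSlack S.B v → e ≠ 0 → ∃ η, T v η) := by
    intro v
    by_cases hv : FreeSlack S.B v
    · have hx : v ≠ Sum.inl x := by
        obtain ⟨k, rfl, -⟩ := hv.exists_eq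
        simp
      obtain ⟨k, rfl, hk⟩ := hv.exists_eq
      by_cases hT : ∃ η, T (Sum.inr k) η
      · obtain ⟨η, hη⟩ := hT
        refine ⟨-((η.2 (Sum.inl x)).eval t * q.eval t), fun e => absurd e hx,
          fun _ e => absurd hv e, fun _ η' hη' => ?_, fun _ _ => ⟨η, hη⟩⟩
        rw [h.eq_unique hη.1 hη'.1 hk hη.2.2 hη'.2.2]
      · exact ⟨0, fun e => absurd e hx, fun _ e => absurd hv e,
          fun _ η hη => absurd ⟨η, hη⟩ hT, fun _ e => absurd rfl e⟩
    · by_cases hx : v = Sum.inl x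
      · exact ⟨_, fun _ => rfl, fun e => absurd hx e, fun e => absurd e hv, fun e => absurd e hv⟩
      · exact ⟨0, fun e => absurd e hx, fun _ _ => rfl, fun e => absurd e hv, fun e => absurd e hv⟩
  choose d d1 d2 d3 d4 using hd
  refine ⟨d, d1 _ rfl, d2, fun v hv hne => ?_, fun δ a ha hH => ?_⟩
  · obtain ⟨η, hη⟩ := d4 v hv hne
    exact ⟨η, hη.1, hη.2.1, hη.2.2, d3 v hv η hη⟩
  have hfree : ∀ v, v ≠ Sum.inl x → d v ≠ 0 → FreeSlack S.B v := fun v hv hne =>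
    by_contra fun hc => hne (d2 v hv hc)
  cases a with
  | le η => exact absurd ha (h.not_le_mem _)
  | dvd g η =>
    simp only [Constraint.Holds] at hH ⊢
    rw [LinTerm.eval_shift t μ d δ η {Sum.inl x}, Finset.sum_singleton, d1 _ rfl]
    -- The shift of `x` is a multiple of `m(t)`, hence of every divisor.
    · have := Polynomial.eval_dvd (x := t) (h.dvd_m g η ha)
      exact dvd_add hH (Dvd.dvd.mul_left (Dvd.dvd.mul_left this _) _)
    · intro v hv
      by_contra! hc
      obtain ⟨k, rfl, hk⟩ := (hfree v (by simpa using hv) hc.2).exists_eq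
      exact hc.1 (h.dvd_free ha hk)
  | eq η =>
    simp only [Constraint.Holds] at hH ⊢
    by_cases hf : ∃ v, FreeSlack S.B v ∧ η.2 v ≠ 0
    · obtain ⟨v, hv, hne⟩ := hf
      have hdv := d3 v hv η ⟨ha, hH, hne⟩
      obtain ⟨k, rfl, hk⟩ := hv.exists_eq
      -- The change of `f * x` per step is `f * m = f * lead * q`, and the slack variable, with
      -- coefficient `lead`, contributes `-(lead * f * q)`.
      rw [LinTerm.eval_shift t μ d δ η {Sum.inl x, Sum.inr k}, Finset.sum_pair (by simp),
        d1 _ rfl, hdv, h.coeff_eq_lead ha hk hne, hH, hq, Polynomial.eval_mul]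
      · ring
      · intro v hv
        simp only [Finset.mem_insert, Finset.mem_singleton, not_or] at hv
        by_contra! hc
        obtain ⟨j, rfl, hj⟩ := (hfree v hv.1 hc.2).exists_eq
        exact hv.2 (congrArg _ (h.free_unique ha hj hk hc.1 hne))
    · push Not at hf
      rw [LinTerm.eval_shift t μ d δ η {Sum.inl x}, Finset.sum_singleton, hH, hA η ha hH hf]
      · ring
      · intro v hv
        by_contra! hc
        exact hc.1 (hf v (hfree v (by simpa using hv) hc.2))

/-- Three cases: a true pivot without free slack variables, a pivot whose slack variable has been
shifted below its slope, and a skip with `x` reduced modulo `m(t)`. -/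
theorem Invariant.exists_iteration (h : Invariant φ S done r c ψ) (hs : Solves t ν xs S μ)
    {x : V} (hx : x ∉ done) (hxs : x ∈ xs) :
    ∃ S' ∈ iteration x S, ∃ μ', Solves t ν xs S' μ' := by
  classical
  have hxd : Sum.inl x ∉ S.B.dom := fun hc => hx ((h.mem_done x).2 (.inl hc))
  by_cases hA : ∃ η, Constraint.eq η ∈ S.φ.atoms ∧ η.eval t μ = 0 ∧
      (∀ v, FreeSlack S.B v → η.2 v = 0) ∧ (η.2 (Sum.inl x)).eval t ≠ 0
  · obtain ⟨η, h1, h2, h3, h4⟩ := hA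
    obtain ⟨s, hs1, hs2⟩ := exists_sign h4
    refine ⟨_, eliminate_mem_iteration h1 (fun e => h4 (by simp [e])) hs1, μ,
      h.eliminate_solves hs h1 h2 (by rw [hs2]; exact abs_pos.2 h4) fun v hv hne => ?_⟩
    exact absurd (h3 v hv) hne
  push Not at hA
  obtain ⟨q, hq⟩ := h.lead_dvd
  obtain ⟨d, hdx, hd0, hdf, hd⟩ := h.exists_direction μ hA hq
  have hm := (h.chi_pos t μ hs.sat_chi).1
  have hdom : ∀ w ∈ S.B.dom, d w = 0 := fun w hw =>
    hd0 w (fun e => hxd (e ▸ hw)) fun hf => hf.2 hw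
  have hshift : ∀ δ : ℤ, (∀ v, FreeSlack S.B v → 0 ≤ μ v + δ * d v) →
      Solves t ν xs S fun v => μ v + δ * d v := by
    intro δ hδ
    refine ⟨fun z hz => ?_, fun w hw => ?_, hδ, PosBool.holds_mono (hd δ) hs.sat,
      Formula.sat_congr t (by simp [h.chi_vars]) hs.sat_chi⟩
    · rw [hd0 _ (fun e => hz (by rwa [Sum.inl.inj e])) (by simp [FreeSlack]), mul_zero, add_zero]
      exact hs.agree z hz
    · rw [hdom w hw, mul_zero, add_zero]
      exact hs.bounds w hw
  by_cases hB : ∃ v, FreeSlack S.B v ∧ d v ≠ 0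
  · obtain ⟨v₀, hv₀, hne₀⟩ := hB
    obtain ⟨δ, h1, v, h2, h3, h4⟩ := exists_shift hs.nonneg hv₀ hne₀
    obtain ⟨η, e1, e2, e3, e4⟩ := hdf v h2 h3
    have hne : (η.2 (Sum.inl x)).eval t ≠ 0 := fun e => h3 (by rw [e4, e]; simp)
    obtain ⟨s, hs1, hs2⟩ := exists_sign hne
    refine ⟨_, eliminate_mem_iteration e1 (fun e => hne (by simp [e])) hs1, _,
      h.eliminate_solves (hshift δ h1) e1 (hd δ _ e1 e2) (by rw [hs2]; exact abs_pos.2 hne)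
        fun w hw hwη => ?_⟩
    obtain ⟨k, rfl, hk⟩ := h2.exists_eq
    obtain ⟨j, rfl, hj⟩ := hw.exists_eq
    obtain rfl := h.free_unique e1 hj hk hwη e3
    -- The slope of the slack variable is `|f| * |q|`. As `m(t) = lead(t) * q(t)` is positive,
    -- `|lead(t)| ≥ 1`, so being below the slope gives the new bound `|f| * m - 1`.
    have hq' : |q.eval t| ≤ S.m.eval t := by
      rw [← abs_of_pos hm, hq, Polynomial.eval_mul, abs_mul]
      refine le_mul_of_one_le_left (abs_nonneg _) (Int.one_le_abs fun e => ?_)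
      rw [hq, Polynomial.eval_mul, e, zero_mul] at hm
      exact lt_irrefl _ hm
    have hle := mul_le_mul_of_nonneg_left hq' (abs_nonneg ((η.2 (Sum.inl x)).eval t))
    have h5 : |d (Sum.inr j)| = |(η.2 (Sum.inl x)).eval t| * |q.eval t| := by
      rw [e4, abs_neg, abs_mul]
    rw [hs2]
    omega
  · push Not at hB
    -- No free slack variable moves, so any multiple of `m(t)` may be subtracted from `x`; this one
    -- leaves the remainder.
    have hsol := hshift (-(μ (Sum.inl x) / S.m.eval t)) fun v hv => by
      rw [hB v hv, mul_zero, add_zero]; exact hs.nonneg v hv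
    refine ⟨PPA.skip x S, by simp [iteration], _, hsol.agree, fun w hw => ?_,
      fun v hv => hsol.nonneg v ⟨hv.1, fun hc => hv.2 ?_⟩, hsol.sat, hsol.sat_chi⟩
    · by_cases hwx : w = Sum.inl x
      · subst hwx
        have e : μ (Sum.inl x) + -(μ (Sum.inl x) / S.m.eval t) * d (Sum.inl x) =
            μ (Sum.inl x) % S.m.eval t := by
          rw [hdx, Int.emod_def]; ring
        simp only [PPA.skip, Function.update_self, e, Polynomial.eval_sub, Polynomial.eval_one]
        exact ⟨Int.emod_nonneg _ hm.ne', Int.le_sub_one_of_lt (Int.emod_lt_of_pos _ hm)⟩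
      · simp only [PPA.skip, Finset.mem_insert, hwx, false_or] at hw
        simp only [PPA.skip, Function.update_of_ne hwx]
        exact hsol.bounds w hw
    · simp only [PPA.skip, Finset.mem_insert]
      exact .inr hc

theorem HasInvariant.exists_loop {φ : Formula V} {S : State V} {done : Set V} {ys : List V}
    (h : HasInvariant φ S done) (hys : ys.Nodup) (hd : ∀ y ∈ ys, y ∉ done ∧ y ∈ xs)
    (hs : Solves t ν xs S μ) : ∃ S' ∈ PPA.loop ys S, ∃ μ', Solves t ν xs S' μ' := by
  induction ys generalizing S done μ with
  | nil => exact ⟨S, by simp [PPA.loop], μ, hs⟩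
  | cons y ys ih =>
    rw [List.nodup_cons] at hys
    obtain ⟨hy, hyx⟩ := hd y (by simp)
    obtain ⟨S', hS', μ', hs'⟩ : ∃ S' ∈ PPA.iteration y S, ∃ μ', Solves t ν xs S' μ' := by
      obtain ⟨ι, _, _, r, c, ψ, h⟩ := h
      exact h.exists_iteration hs hy hyx
    obtain ⟨S'', hS'', hsol⟩ := ih (h.iteration hy hS') hys.2 (fun z hz => by
      refine ⟨?_, (hd z (by simp [hz])).2⟩
      rintro (rfl | hz')
      · exact hys.1 hz
      · exact (hd z (by simp [hz])).1 hz') hs'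
    exact ⟨S'', List.mem_flatMap.2 ⟨S', hS', hS''⟩, hsol⟩

theorem mem_initStates {φ : Formula V} {S : State V} (h : S ∈ initStates φ) :
    ∃ Z s, S = initState φ Z s := by
  simp only [initStates, List.mem_flatMap, List.mem_map] at h
  obtain ⟨Z, -, s, -, rfl⟩ := h
  exact ⟨Z, s, rfl⟩

theorem exists_initState {φ : Formula V} (h : φ.ExSat xs t fun v => ν (Sum.inl v)) :
    ∃ S ∈ initStates φ, ∃ μ, Solves t ν xs S μ := by
  classical
  obtain ⟨μ₀, hμ₀, hsat⟩ := h
  -- The right guess is the set of all divisors that vanish at `t`; the product of the remaining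
  -- ones is then nonzero at `t`.
  let Z := φ.divisors.dedup.filter fun f => f.eval t = 0
  have hZ : ∀ f ∈ Z, f.eval t = 0 := fun f hf => by simpa using (List.mem_filter.1 hf).2
  obtain ⟨μ, h1, h2, h3⟩ := exists_addSlack_sat ((zeroDivisors_sat Z φ t μ₀).2 ⟨hsat, hZ⟩)
  have hne : (zeroDivisors Z φ).divisors.dedup.prod.eval t ≠ 0 := by
    rw [Polynomial.eval_list_prod]
    refine List.prod_ne_zero fun h0 => ?_
    obtain ⟨f, hf, hf0⟩ := List.mem_map.1 h0
    obtain ⟨hf1, hf2⟩ := divisors_zeroDivisors (List.mem_dedup.1 hf)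
    exact hf2 (List.mem_filter.2 ⟨List.mem_dedup.2 hf1, by simpa using hf0⟩)
  obtain ⟨s, hs1, hs2⟩ := exists_sign hne
  refine ⟨initState φ Z s, ?_, μ, fun z hz => ?_, ?_, fun v hv => ?_, h3, ?_⟩
  · simp only [initStates, List.mem_flatMap, List.mem_map]
    refine ⟨Z, ?_, s, by rcases hs1 with rfl | rfl <;> simp, rfl⟩
    rw [List.mem_sublists]
    convert List.filter_sublist (l := φ.divisors.dedup) (p := fun f => decide (f.eval t = 0))
  · rw [h1, hμ₀ z hz]
  · intro w hw
    simp [initState] at hw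
  · obtain ⟨k, rfl, -⟩ := hv.exists_eq
    exact h2 k
  · refine (Formula.sat_pos _ _ _).2 ?_
    rw [Polynomial.eval_mul, Polynomial.eval_C]
    exact lt_of_lt_of_eq (abs_pos.2 hne) hs2.symm

theorem hasInvariant_of_mem_loop {φ : Formula V} (hxs : xs.Nodup)
    (hS : S ∈ (initStates φ).flatMap (loop xs)) :
    ∃ Z, HasInvariant (zeroDivisors Z φ) S {x | x ∈ xs} := by
  obtain ⟨S₀, h1, h2⟩ := List.mem_flatMap.1 hS
  obtain ⟨Z, s, rfl⟩ := mem_initStates h1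
  have := hasInvariant_initState.loop hxs (by simp) h2
  exact ⟨Z, by simpa using this⟩

end Complete

end PPA

/-! ### The three claims of the lemma -/

theorem mainTheorem4 {V : Type*} (xs : List V) (hxs : xs.Nodup) (φ : PPA.Formula V) :
    -- global specification: the disjunction of all outputs is equivalent to the input
    (∀ (t : ℤ) (ν : V ⊕ ℕ → ℤ),
      (∃ F ∈ PPA.boundedQE xs φ, F.Sat t ν) ↔ φ.ExSat xs t (fun v => ν (Sum.inl v))) ∧
    -- each output is a formula `∃ w ≤ B : ψ(w, z)`, where `w` consists of variables from `xs` and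
    -- slack variables, and `z` of the free variables of the input
    (∀ F ∈ PPA.boundedQE xs φ,
      (∀ z : V, Sum.inl z ∈ F.B.dom → z ∈ xs) ∧
      ∀ v ∈ PPA.Formula.vars F.body,
        v ∈ F.B.dom ∨ ∃ z ∈ PPA.Formula.vars φ, z ∉ xs ∧ v = Sum.inl z) ∧
    -- every division performed in any branch is by a nonzero polynomial and without remainder
    (∀ (pre : List V) (x : V) (post : List V), xs = pre ++ x :: post →
      ∀ S ∈ (PPA.initStates φ).flatMap (PPA.loop pre), ∀ η ∈ PPA.pivots x S,
        S.lead ≠ 0 ∧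
        ∀ c ∈ (S.φ.map (PPA.Constraint.vigSub (η.2 (Sum.inl x))
            (PPA.LinTerm.erase (Sum.inl x) η) (Sum.inl x))).atoms,
          c.DivisibleBy S.lead) := by
  refine ⟨fun t ν => ⟨?_, fun h => ?_⟩, ?_, ?_⟩
  · rintro ⟨F, hF, hs⟩
    obtain ⟨S, hS, rfl⟩ := List.mem_map.1 hF
    obtain ⟨Z, ι, _, _, r, c, ψ, h⟩ := PPA.hasInvariant_of_mem_loop hxs hS
    obtain ⟨μ, h1, h2⟩ := h.exists_sat_of_finish hs
    exact ⟨μ, h1, ((PPA.zeroDivisors_sat _ _ _ _).1 h2).1⟩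
  · obtain ⟨S₀, hS₀, μ, hs⟩ := PPA.exists_initState h
    obtain ⟨Z, s, rfl⟩ := PPA.mem_initStates hS₀
    obtain ⟨S, hS, μ', hs'⟩ := PPA.hasInvariant_initState.exists_loop hxs
      (fun y hy => ⟨by simp, hy⟩) hs
    have hS' := List.mem_flatMap.2 ⟨_, hS₀, hS⟩
    obtain ⟨Z', ι, _, _, r, c, ψ, hi⟩ := PPA.hasInvariant_of_mem_loop hxs hS'
    exact ⟨_, List.mem_map.2 ⟨S, hS', rfl⟩, hi.finish_sat hs'⟩
  · intro F hF
    obtain ⟨S, hS, rfl⟩ := List.mem_map.1 hF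
    obtain ⟨Z, ι, _, _, r, c, ψ, h⟩ := PPA.hasInvariant_of_mem_loop hxs hS
    refine ⟨fun z hz => (h.mem_done z).2 (.inl hz), fun v hv => (h.vars_finish hv).imp id ?_⟩
    rintro ⟨z, hz, hz'⟩
    exact ⟨z, PPA.vars_zeroDivisors _ _ hz, hz'⟩
  -- The state before `x` is the result of the loop on the prefix `pre`, which has no duplicates
  -- either.
  · rintro pre x post rfl S hS η hη
    obtain ⟨Z, ι, _, _, r, c, ψ, h⟩ := PPA.hasInvariant_of_mem_loop
      (List.Nodup.of_append_left hxs) hS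
    exact ⟨h.lead_eq ▸ h.det_ne, h.divisible hη⟩
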